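/- Let $R$ be a ring, not necessarily with a unit, which is right non-degenerate, i.e. $rR=0$ implies $r=0$ for $r\in R$. Let $(P,Q,\psi)$ be an $R$-system: $P,Q$ are $R$-bimodules and $\psi:P\otimes Q\to R$ is an $R$-bimodule homomorphism, where $\otimes$ is the $R$-balanced tensor product. For $q\in Q$, $p\in P$ let $\theta_{q,p}:Q\to Q$, $x\mapsto q\,\psi(p\otimes x)$, and $\theta_{p,q}:P\to P$, $y\mapsto \psi(y\otimes q)\,p$, and let $\mathcal F_P(Q)$ and $\mathcal F_Q(P)$ be the additive groups spanned by the $\theta_{q,p}$ and by the $\theta_{p,q}$ respectively. Assume condition (FS): for all finite sets $\{q_1,\dots,q_n\}\subseteq Q$ and $\{p_1,\dots,p_m\}\subseteq P$ there are $\Theta\in\mathcal F_P(Q)$ and $\Delta\in\mathcal F_Q(P)$ with $\Theta(q_i)=q_i$ and $\Delta(p_j)=p_j$ for all $i,j$. A covariant representation $(S,T,\sigma,B)$ of $(P,Q,\psi)$ consists of a ring $B$, additive maps $S:P\to B$, $T:Q\to B$ and a ring homomorphism $\sigma:R\to B$ such that $S(pr)=S(p)\sigma(r)$, $S(rp)=\sigma(r)S(p)$,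 $T(qr)=T(q)\sigma(r)$, $T(rq)=\sigma(r)T(q)$ and $\sigma(\psi(p\otimes q))=S(p)T(q)$ for all $p\in P$, $q\in Q$, $r\in R$. The Toeplitz representation $(\iota_P,\iota_Q,\iota_R,\mathcal T_{(P,Q,\psi)})$ is the universal covariant representation: $\mathcal T_{(P,Q,\psi)}$ is generated as a ring by $\iota_R(R)\cup\iota_Q(Q)\cup\iota_P(P)$, and for every covariant representation $(S,T,\sigma,B)$ there is a unique ring homomorphism $\eta:\mathcal T_{(P,Q,\psi)}\to B$ with $\eta\circ\iota_R=\sigma$, $\eta\circ\iota_Q=T$, $\eta\circ\iota_P=S$. Let $F(Q)=\bigoplus_{n\ge0}Q^{\otimes n}$ and $F(P)=\bigoplus_{n\ge0}P^{\otimes n}$, where $Q^{\otimes0}=P^{\otimes0}=R$. These bimodules are paired by $\langle\{p_n\},\{q_n\}\rangle=\sum_n\psi_n(p_n\otimes q_n)$, where $\psi_0(r\otimes s)=rs$, $\psi_1=\psi$ and $\psi_{n+1}\bigl((p\otimes x)\otimes(y\otimes q)\bigr)=\psi\bigl(p\,\psi_n(x\otimes y)\otimes q\bigr)$ for $n\ge1$,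 $p\in P$, $x\in P^{\otimes n}$, $y\in Q^{\otimes n}$, $q\in Q$. Let $\mathcal L_{F(P)}(F(Q))$ be the ring of right $R$-linear endomorphisms of $F(Q)$ that have a left $R$-linear adjoint on $F(P)$ with respect to this pairing. For $q\in Q$, $p\in P$, $r\in R$ let $T_q,S_p,\phi_\infty(r)\in\mathcal L_{F(P)}(F(Q))$ be given by $T_q(\{q_n\})=\{0,qq_0,q\otimes q_1,q\otimes q_2,\dots\}$, by $S_p(x\otimes y)=\psi(p\otimes x)y$ for $x\in Q$, $y\in Q^{\otimes n}$ with $n\ge1$, $S_p(x)=\psi(p\otimes x)$ for $x\in Q$, $S_p(Q^{\otimes0})=0$, and by $\phi_\infty(r)(\{q_n\})=\{rq_n\}$. Let $\mathcal F_{(P,Q,\psi)}$ be the subring of $\mathcal L_{F(P)}(F(Q))$ generated by all $T_q$, $S_p$, $\phi_\infty(r)$. The Fock space representation is $(S_{\mathcal F},T_{\mathcal F},\sigma_{\mathcal F},\mathcal F_{(P,Q,\psi)})$ with $S_{\mathcal F}(p)=S_p$, $T_{\mathcal F}(q)=T_q$, $\sigma_{\mathcal F}(r)=\phi_\infty(r)$.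 Then the Fock space representation is isomorphic to the Toeplitz representation: there is a ring isomorphism $\Phi:\mathcal F_{(P,Q,\psi)}\to\mathcal T_{(P,Q,\psi)}$ with $\Phi\circ S_{\mathcal F}=\iota_P$, $\Phi\circ T_{\mathcal F}=\iota_Q$ and $\Phi\circ\sigma_{\mathcal F}=\iota_R$. -/

import Mathlib

open scoped DirectSum

universe u v w

/-! Rings are not assumed to have a unit, and bimodules are not assumed to be unital. -/

/-- A ring `R` is right non-degenerate if `r R = 0` implies `r = 0`. -/
def RightNondegenerate (R : Type u) [NonUnitalRing R] : Prop :=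
  ∀ r : R, (∀ s : R, r * s = 0) → r = 0

/-- A bimodule over a (not necessarily unital) ring `R`: an abelian group with commuting
biadditive associative left and right actions. Here `lsmul r x` is `r x`, `rsmul r x` is `x r`. -/
structure RingBimodule (R : Type u) [NonUnitalRing R] where
  carrier : Type u
  [addCommGroup : AddCommGroup carrier]
  lsmul : R →+ carrier →+ carrier
  rsmul : R →+ carrier →+ carrier
  mul_lsmul : ∀ (r s : R) (x : carrier), lsmul (r * s) x = lsmul r (lsmul s x)
  mul_rsmul : ∀ (r s : R) (x : carrier), rsmul (r * s) x = rsmul s (rsmul r x)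
  lsmul_rsmul : ∀ (r s : R) (x : carrier), lsmul r (rsmul s x) = rsmul s (lsmul r x)

attribute [instance] RingBimodule.addCommGroup

/-- Right `R`-module homomorphisms between two bimodules. -/
structure RightHom {R : Type u} [NonUnitalRing R] (M N : RingBimodule R) where
  toAddHom : M.carrier →+ N.carrier
  map_rsmul : ∀ (r : R) (x : M.carrier), toAddHom (M.rsmul r x) = N.rsmul r (toAddHom x)

/-- Left `R`-module homomorphisms between two bimodules. -/
structure LeftHom {R : Type u} [NonUnitalRing R] (M N : RingBimodule R) where
  toAddHom : M.carrier →+ N.carrier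
  map_lsmul : ∀ (r : R) (x : M.carrier), toAddHom (M.lsmul r x) = N.lsmul r (toAddHom x)

/-- `R`-bimodule homomorphisms. -/
structure BimoduleHom {R : Type u} [NonUnitalRing R] (M N : RingBimodule R) where
  toAddHom : M.carrier →+ N.carrier
  map_lsmul : ∀ (r : R) (x : M.carrier), toAddHom (M.lsmul r x) = N.lsmul r (toAddHom x)
  map_rsmul : ∀ (r : R) (x : M.carrier), toAddHom (M.rsmul r x) = N.rsmul r (toAddHom x)

namespace RingBimodule

variable {R : Type u} [NonUnitalRing R]

/-- The regular bimodule `R`. -/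
def regular (R : Type u) [NonUnitalRing R] : RingBimodule R where
  carrier := R
  lsmul := AddMonoidHom.mul
  rsmul := AddMonoidHom.mul.flip
  mul_lsmul r s x := mul_assoc r s x
  mul_rsmul r s x := (mul_assoc x r s).symm
  lsmul_rsmul r s x := (mul_assoc r x s).symm

/-- The subgroup of `M ⊗_ℤ N` generated by all `m r ⊗ n - m ⊗ r n`. -/
def balanceSubgroup (M N : RingBimodule R) :
    AddSubgroup (TensorProduct ℤ M.carrier N.carrier) :=
  AddSubgroup.closure
    {z | ∃ (m : M.carrier) (r : R) (n : N.carrier),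
      z = TensorProduct.tmul ℤ (M.rsmul r m) n - TensorProduct.tmul ℤ m (N.lsmul r n)}

/-- The underlying group of the `R`-balanced tensor product `M ⊗ N`. -/
def TensorCarrier (M N : RingBimodule R) : Type u :=
  TensorProduct ℤ M.carrier N.carrier ⧸ balanceSubgroup M N

instance (M N : RingBimodule R) : AddCommGroup (TensorCarrier M N) :=
  inferInstanceAs (AddCommGroup (TensorProduct ℤ M.carrier N.carrier ⧸ balanceSubgroup M N))

/-- The elementary tensor `m ⊗ n`, as a biadditive map. -/
def tmul (M N : RingBimodule R) : M.carrier →+ N.carrier →+ TensorCarrier M N :=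
  AddMonoidHom.mk' (fun m => AddMonoidHom.mk'
      (fun n => QuotientAddGroup.mk' (balanceSubgroup M N) (TensorProduct.tmul ℤ m n))
      (fun a b => by rw [TensorProduct.tmul_add]; exact map_add _ _ _))
    (fun a b => by
      ext n
      change QuotientAddGroup.mk' (balanceSubgroup M N) (TensorProduct.tmul ℤ (a + b) n) = _
      rw [TensorProduct.add_tmul]; exact map_add _ _ _)

theorem tmul_balanced (M N : RingBimodule R) (m : M.carrier) (r : R) (n : N.carrier) :
    tmul M N (M.rsmul r m) n = tmul M N m (N.lsmul r n) :=
  QuotientAddGroup.eq_iff_sub_mem.2 (AddSubgroup.subset_closure ⟨m, r, n, rfl⟩)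

/-- The universal property of the balanced tensor product. -/
def tlift {M N : RingBimodule R} {A : Type*} [AddCommGroup A]
    (f : M.carrier →+ N.carrier →+ A)
    (hf : ∀ (m : M.carrier) (r : R) (n : N.carrier), f (M.rsmul r m) n = f m (N.lsmul r n)) :
    TensorCarrier M N →+ A :=
  QuotientAddGroup.lift (balanceSubgroup M N)
    (TensorProduct.liftAddHom f (fun k m n => by simp)) (by
      refine (AddSubgroup.closure_le _).2 ?_
      rintro _ ⟨m, r, n, rfl⟩
      change _ = _
      rw [map_sub]
      exact sub_eq_zero.2 (hf m r n))

theorem tlift_tmul {M N : RingBimodule R} {A : Type*} [AddCommGroup A]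
    (f : M.carrier →+ N.carrier →+ A)
    (hf : ∀ (m : M.carrier) (r : R) (n : N.carrier), f (M.rsmul r m) n = f m (N.lsmul r n))
    (m : M.carrier) (n : N.carrier) : tlift f hf (tmul M N m n) = f m n := rfl

theorem tensor_ext {M N : RingBimodule R} {A : Type*} [AddCommGroup A]
    {f g : TensorCarrier M N →+ A} (h : ∀ m n, f (tmul M N m n) = g (tmul M N m n)) : f = g := by
  ext x
  obtain ⟨y, rfl⟩ := QuotientAddGroup.mk'_surjective (balanceSubgroup M N) x
  induction y with
  | zero => exact (map_zero f).trans (map_zero g).symm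
  | tmul m n => exact h m n
  | add a b ha hb =>
    rw [map_add]
    exact (map_add f _ _).trans ((congrArg₂ (· + ·) ha hb).trans (map_add g _ _).symm)

/-- Functoriality of the balanced tensor product. -/
def tmap {M M' N N' : RingBimodule R} (f : RightHom M M') (g : LeftHom N N') :
    TensorCarrier M N →+ TensorCarrier M' N' :=
  tlift (((tmul M' N').comp f.toAddHom).compl₂ g.toAddHom) (by
    intro m r n
    change tmul M' N' (f.toAddHom (M.rsmul r m)) (g.toAddHom n)
      = tmul M' N' (f.toAddHom m) (g.toAddHom (N.lsmul r n))
    rw [f.map_rsmul, g.map_lsmul, tmul_balanced])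

theorem tmap_tmul {M M' N N' : RingBimodule R} (f : RightHom M M') (g : LeftHom N N')
    (m : M.carrier) (n : N.carrier) :
    tmap f g (tmul M N m n) = tmul M' N' (f.toAddHom m) (g.toAddHom n) := rfl

/-- Left multiplication by `r` is right linear. -/
def lsmulHom (M : RingBimodule R) (r : R) : RightHom M M := ⟨M.lsmul r, M.lsmul_rsmul r⟩

/-- Right multiplication by `r` is left linear. -/
def rsmulHom (M : RingBimodule R) (r : R) : LeftHom M M :=
  ⟨M.rsmul r, fun s x => (M.lsmul_rsmul s r x).symm⟩

def RightHom.id (M : RingBimodule R) : RightHom M M := ⟨AddMonoidHom.id _, fun _ _ => rfl⟩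

def LeftHom.id (M : RingBimodule R) : LeftHom M M := ⟨AddMonoidHom.id _, fun _ _ => rfl⟩

/-- The `R`-balanced tensor product `M ⊗ N` with its bimodule structure
`r (m ⊗ n) = r m ⊗ n`, `(m ⊗ n) r = m ⊗ n r`. -/
def tensor (M N : RingBimodule R) : RingBimodule R where
  carrier := TensorCarrier M N
  lsmul := AddMonoidHom.mk' (fun r => tmap (lsmulHom M r) (LeftHom.id N)) (fun r s => by
    apply tensor_ext; intro m n
    change tmul M N (M.lsmul (r + s) m) n = tmul M N (M.lsmul r m) n + tmul M N (M.lsmul s m) n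
    simp)
  rsmul := AddMonoidHom.mk' (fun r => tmap (RightHom.id M) (rsmulHom N r)) (fun r s => by
    apply tensor_ext; intro m n
    change tmul M N m (N.rsmul (r + s) n) = tmul M N m (N.rsmul r n) + tmul M N m (N.rsmul s n)
    simp)
  mul_lsmul r s := DFunLike.congr_fun (tensor_ext
    (f := tmap (lsmulHom M (r * s)) (LeftHom.id N))
    (g := (tmap (lsmulHom M r) (LeftHom.id N)).comp (tmap (lsmulHom M s) (LeftHom.id N)))
    (fun m n => congrArg (fun z => tmul M N z n) (M.mul_lsmul r s m)))
  mul_rsmul r s := DFunLike.congr_fun (tensor_ext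
    (f := tmap (RightHom.id M) (rsmulHom N (r * s)))
    (g := (tmap (RightHom.id M) (rsmulHom N s)).comp (tmap (RightHom.id M) (rsmulHom N r)))
    (fun m n => congrArg (tmul M N m) (N.mul_rsmul r s n)))
  lsmul_rsmul r s := DFunLike.congr_fun (tensor_ext
    (f := (tmap (lsmulHom M r) (LeftHom.id N)).comp (tmap (RightHom.id M) (rsmulHom N s)))
    (g := (tmap (RightHom.id M) (rsmulHom N s)).comp (tmap (lsmulHom M r) (LeftHom.id N)))
    (fun _ _ => rfl))

/-- `f ⊗ id` for a right linear map `f`. -/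
def tmapRight {M M' : RingBimodule R} (f : RightHom M M') (N : RingBimodule R) :
    RightHom (M.tensor N) (M'.tensor N) where
  toAddHom := tmap f (LeftHom.id N)
  map_rsmul r := DFunLike.congr_fun (tensor_ext
    (f := (tmap f (LeftHom.id N)).comp (tmap (RightHom.id M) (rsmulHom N r)))
    (g := (tmap (RightHom.id M') (rsmulHom N r)).comp (tmap f (LeftHom.id N)))
    (fun _ _ => rfl))

/-- The tensor powers: `M^{⊗0} = R`, `M^{⊗1} = M` and `M^{⊗n} = M^{⊗(n-1)} ⊗ M` for `n > 1`. -/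
def tpow (M : RingBimodule R) : ℕ → RingBimodule R
  | 0 => regular R
  | 1 => M
  | n + 2 => (M.tpow (n + 1)).tensor M

/-- The right linear map `M^{⊗n} → M^{⊗(n+1)}`, `x ↦ m ⊗ x` (for `n = 0` this is `r ↦ m r`). -/
def tensorLeft (M : RingBimodule R) (m : M.carrier) :
    (n : ℕ) → RightHom (M.tpow n) (M.tpow (n + 1))
  | 0 => ⟨M.rsmul.flip m, fun r s => M.mul_rsmul s r m⟩
  | 1 => ⟨tmul M M m, fun _ _ => rfl⟩
  | n + 2 => tmapRight (M.tensorLeft m (n + 1)) M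

theorem tensorLeft_add (M : RingBimodule R) (m m' : M.carrier) : ∀ n : ℕ,
    (M.tensorLeft (m + m') n).toAddHom = (M.tensorLeft m n).toAddHom + (M.tensorLeft m' n).toAddHom
  | 0 => map_add M.rsmul.flip m m'
  | 1 => map_add (tmul M M) m m'
  | n + 2 => tensor_ext fun y q => by
      change tmul _ M ((M.tensorLeft (m + m') (n + 1)).toAddHom y) q
        = tmul _ M ((M.tensorLeft m (n + 1)).toAddHom y) q
          + tmul _ M ((M.tensorLeft m' (n + 1)).toAddHom y) q
      rw [tensorLeft_add M m m' (n + 1)]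
      simp

theorem tensorLeft_lsmul (M : RingBimodule R) (r : R) (m : M.carrier) : ∀ n : ℕ,
    (M.tensorLeft (M.lsmul r m) n).toAddHom
      = ((M.tpow (n + 1)).lsmul r).comp (M.tensorLeft m n).toAddHom
  | 0 => AddMonoidHom.ext fun s => (M.lsmul_rsmul r s m).symm
  | 1 => rfl
  | n + 2 => tensor_ext fun y q =>
      congrArg (fun z => tmul _ M z q) (DFunLike.congr_fun (tensorLeft_lsmul M r m (n + 1)) y)

theorem tensorLeft_rsmul (M : RingBimodule R) (r : R) (m : M.carrier) : ∀ n : ℕ,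
    (M.tensorLeft (M.rsmul r m) n).toAddHom
      = (M.tensorLeft m n).toAddHom.comp ((M.tpow n).lsmul r)
  | 0 => AddMonoidHom.ext fun s => (M.mul_rsmul r s m).symm
  | 1 => AddMonoidHom.ext fun s => tmul_balanced M M m r s
  | n + 2 => tensor_ext fun y q =>
      congrArg (fun z => tmul _ M z q) (DFunLike.congr_fun (tensorLeft_rsmul M r m (n + 1)) y)

/-- The left linear map `M^{⊗n} → M^{⊗(n+1)}`, `x ↦ x ⊗ m` (for `n = 0` this is `r ↦ r m`). -/
def tensorRight (M : RingBimodule R) (m : M.carrier) :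
    (n : ℕ) → LeftHom (M.tpow n) (M.tpow (n + 1))
  | 0 => ⟨M.lsmul.flip m, fun r s => M.mul_lsmul r s m⟩
  | n + 1 => ⟨(tmul (M.tpow (n + 1)) M).flip m, fun _ _ => rfl⟩

/-- The bimodule `F(M) = ⨁_{n ≥ 0} M^{⊗n}` underlying the Fock ring of `M`. -/
def fock (M : RingBimodule R) : RingBimodule R where
  carrier := ⨁ n : ℕ, (M.tpow n).carrier
  lsmul := AddMonoidHom.mk' (fun r => DirectSum.map fun n => (M.tpow n).lsmul r) (fun r s => by
    ext n x : 2; simp)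
  rsmul := AddMonoidHom.mk' (fun r => DirectSum.map fun n => (M.tpow n).rsmul r) (fun r s => by
    ext n x : 2; simp)
  mul_lsmul r s x := by
    refine DFinsupp.ext fun n => ?_
    simp [DirectSum.map_apply, (M.tpow n).mul_lsmul]
  mul_rsmul r s x := by
    refine DFinsupp.ext fun n => ?_
    simp [DirectSum.map_apply, (M.tpow n).mul_rsmul]
  lsmul_rsmul r s x := by
    refine DFinsupp.ext fun n => ?_
    simp [DirectSum.map_apply, (M.tpow n).lsmul_rsmul]

end RingBimodule

open RingBimodule in
/-- An `R`-system `(P, Q, ψ)`: two `R`-bimodules and a bimodule homomorphism `ψ : P ⊗ Q → R`. -/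
structure RSystem (R : Type u) [NonUnitalRing R] where
  P : RingBimodule R
  Q : RingBimodule R
  ψ : BimoduleHom (P.tensor Q) (regular R)

namespace RSystem

open RingBimodule

variable {R : Type u} [NonUnitalRing R]

/-- The element `ψ (p ⊗ q)` of `R`. -/
def pair (X : RSystem R) (p : X.P.carrier) (q : X.Q.carrier) : R :=
  X.ψ.toAddHom (tmul X.P X.Q p q)

/-- `p ↦ (q ↦ ψ (p ⊗ q))` as a biadditive map. -/
def pairHom (X : RSystem R) : X.P.carrier →+ X.Q.carrier →+ R :=
  (tmul X.P X.Q).compr₂ X.ψ.toAddHom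

theorem pair_lsmul (X : RSystem R) (r : R) (p : X.P.carrier) (q : X.Q.carrier) :
    X.pair (X.P.lsmul r p) q = r * X.pair p q := X.ψ.map_lsmul r (tmul X.P X.Q p q)

theorem pair_rsmul (X : RSystem R) (r : R) (p : X.P.carrier) (q : X.Q.carrier) :
    X.pair p (X.Q.rsmul r q) = X.pair p q * r := X.ψ.map_rsmul r (tmul X.P X.Q p q)

theorem pair_balanced (X : RSystem R) (r : R) (p : X.P.carrier) (q : X.Q.carrier) :
    X.pair (X.P.rsmul r p) q = X.pair p (X.Q.lsmul r q) :=
  congrArg X.ψ.toAddHom (tmul_balanced X.P X.Q p r q)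

/-- A balanced biadditive map that is left linear in the first and right linear in the second
variable gives an `R`-system. -/
def ofBalanced (M N : RingBimodule R) (f : M.carrier →+ N.carrier →+ R)
    (hb : ∀ m r n, f (M.rsmul r m) n = f m (N.lsmul r n))
    (hl : ∀ r m n, f (M.lsmul r m) n = r * f m n)
    (hr : ∀ r m n, f m (N.rsmul r n) = f m n * r) : RSystem R where
  P := M
  Q := N
  ψ :=
    { toAddHom := tlift f hb
      map_lsmul := fun r => DFunLike.congr_fun (tensor_ext
        (f := (tlift f hb).comp (tmap (lsmulHom M r) (LeftHom.id N)))
        (g := (AddMonoidHom.mulLeft r).comp (tlift f hb)) (fun m n => hl r m n))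
      map_rsmul := fun r => DFunLike.congr_fun (tensor_ext
        (f := (tlift f hb).comp (tmap (RightHom.id M) (rsmulHom N r)))
        (g := (AddMonoidHom.mulRight r).comp (tlift f hb)) (fun m n => hr r m n)) }

/-- The right linear map `Q ⊗ M → M`, `q ⊗ x ↦ ψ(p ⊗ q) x`. -/
def contractLeftOne (X : RSystem R) (p : X.P.carrier) (M : RingBimodule R) :
    RightHom (X.Q.tensor M) M :=
  have hb : ∀ (q : X.Q.carrier) (r : R) (x : M.carrier),
      (M.lsmul.comp (X.pairHom p)) (X.Q.rsmul r q) x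
        = (M.lsmul.comp (X.pairHom p)) q (M.lsmul r x) := fun q r x => by
    change M.lsmul (X.pair p (X.Q.rsmul r q)) x = M.lsmul (X.pair p q) (M.lsmul r x)
    rw [pair_rsmul, M.mul_lsmul]
  { toAddHom := tlift (M.lsmul.comp (X.pairHom p)) hb
    map_rsmul := fun r => DFunLike.congr_fun (tensor_ext
      (f := (tlift (M.lsmul.comp (X.pairHom p)) hb).comp (tmap (RightHom.id X.Q) (rsmulHom M r)))
      (g := (M.rsmul r).comp (tlift (M.lsmul.comp (X.pairHom p)) hb))
      (fun q x => M.lsmul_rsmul (X.pair p q) r x)) }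

/-- The left linear map `M ⊗ P → M`, `x ⊗ p ↦ x ψ(p ⊗ q)`. -/
def contractRightOne (X : RSystem R) (q : X.Q.carrier) (M : RingBimodule R) :
    LeftHom (M.tensor X.P) M :=
  have hb : ∀ (x : M.carrier) (r : R) (p : X.P.carrier),
      (M.rsmul.comp (X.pairHom.flip q)).flip (M.rsmul r x) p
        = (M.rsmul.comp (X.pairHom.flip q)).flip x (X.P.lsmul r p) := fun x r p => by
    change M.rsmul (X.pair p q) (M.rsmul r x) = M.rsmul (X.pair (X.P.lsmul r p) q) x
    rw [pair_lsmul, M.mul_rsmul]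
  { toAddHom := tlift (M.rsmul.comp (X.pairHom.flip q)).flip hb
    map_lsmul := fun r => DFunLike.congr_fun (tensor_ext
      (f := (tlift (M.rsmul.comp (X.pairHom.flip q)).flip hb).comp
        (tmap (lsmulHom M r) (LeftHom.id X.P)))
      (g := (M.lsmul r).comp (tlift (M.rsmul.comp (X.pairHom.flip q)).flip hb))
      (fun x p => (M.lsmul_rsmul r (X.pair p q) x).symm)) }

/-- The right linear map `S_p^{(n)} : Q^{⊗(n+1)} → Q^{⊗n}`, `q ⊗ x ↦ ψ(p ⊗ q) x`
(for `n = 0` this is `q ↦ ψ(p ⊗ q)`). -/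
def contractLeft (X : RSystem R) (p : X.P.carrier) :
    (n : ℕ) → RightHom (X.Q.tpow (n + 1)) (X.Q.tpow n)
  | 0 => ⟨X.pairHom p, fun r q => X.pair_rsmul r p q⟩
  | 1 => X.contractLeftOne p X.Q
  | n + 2 => tmapRight (X.contractLeft p (n + 1)) X.Q

/-- The left linear map `U_q^{(n)} : P^{⊗(n+1)} → P^{⊗n}`, `x ⊗ p ↦ x ψ(p ⊗ q)`
(for `n = 0` this is `p ↦ ψ(p ⊗ q)`). -/
def contractRight (X : RSystem R) (q : X.Q.carrier) :
    (n : ℕ) → LeftHom (X.P.tpow (n + 1)) (X.P.tpow n)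
  | 0 => ⟨X.pairHom.flip q, fun r p => X.pair_lsmul r p q⟩
  | n + 1 => X.contractRightOne q (X.P.tpow (n + 1))

theorem contractLeft_add (X : RSystem R) (p p' : X.P.carrier) : ∀ n : ℕ,
    (X.contractLeft (p + p') n).toAddHom
      = (X.contractLeft p n).toAddHom + (X.contractLeft p' n).toAddHom
  | 0 => map_add X.pairHom p p'
  | 1 => tensor_ext fun (q : X.Q.carrier) (x : X.Q.carrier) => by
      change X.Q.lsmul (X.pairHom (p + p') q) x
        = X.Q.lsmul (X.pairHom p q) x + X.Q.lsmul (X.pairHom p' q) x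
      simp
  | n + 2 => tensor_ext fun y q => by
      change tmul _ X.Q ((X.contractLeft (p + p') (n + 1)).toAddHom y) q
        = tmul _ X.Q ((X.contractLeft p (n + 1)).toAddHom y) q
          + tmul _ X.Q ((X.contractLeft p' (n + 1)).toAddHom y) q
      rw [contractLeft_add X p p' (n + 1)]
      simp

theorem contractLeft_lsmul (X : RSystem R) (r : R) (p : X.P.carrier) : ∀ n : ℕ,
    (X.contractLeft (X.P.lsmul r p) n).toAddHom
      = ((X.Q.tpow n).lsmul r).comp (X.contractLeft p n).toAddHom
  | 0 => AddMonoidHom.ext fun q => X.pair_lsmul r p q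
  | 1 => tensor_ext fun (q : X.Q.carrier) (x : X.Q.carrier) => by
      change X.Q.lsmul (X.pair (X.P.lsmul r p) q) x = X.Q.lsmul r (X.Q.lsmul (X.pair p q) x)
      rw [pair_lsmul, X.Q.mul_lsmul]
  | n + 2 => tensor_ext fun y q =>
      congrArg (fun z => tmul _ X.Q z q)
        (DFunLike.congr_fun (contractLeft_lsmul X r p (n + 1)) y)

theorem contractLeft_rsmul (X : RSystem R) (r : R) (p : X.P.carrier) : ∀ n : ℕ,
    (X.contractLeft (X.P.rsmul r p) n).toAddHom
      = (X.contractLeft p n).toAddHom.comp ((X.Q.tpow (n + 1)).lsmul r)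
  | 0 => AddMonoidHom.ext fun q => X.pair_balanced r p q
  | 1 => tensor_ext fun q x =>
      congrArg (fun z => X.Q.lsmul z x) (X.pair_balanced r p q)
  | n + 2 => tensor_ext fun y q =>
      congrArg (fun z => tmul _ X.Q z q)
        (DFunLike.congr_fun (contractLeft_rsmul X r p (n + 1)) y)

/-- `S_p^{(n)}` as an additive function of `p`. -/
def contractLeftHom (X : RSystem R) (n : ℕ) :
    X.P.carrier →+ (X.Q.tpow (n + 1)).carrier →+ (X.Q.tpow n).carrier :=
  AddMonoidHom.mk' (fun p => (X.contractLeft p n).toAddHom) (fun p p' => X.contractLeft_add p p' n)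

/-- For an `R`-system `Y` on `(P^{⊗(n+1)}, Q^{⊗(n+1)})`, the map `(x ⊗ p, y) ↦ Y(x ⊗ S_p y)`. -/
def stepHom (X : RSystem R) (n : ℕ)
    (φ : BimoduleHom ((X.P.tpow (n + 1)).tensor (X.Q.tpow (n + 1))) (regular R)) :
    TensorCarrier (X.P.tpow (n + 1)) X.P →+ (X.Q.tpow (n + 2)).carrier →+ R :=
  tlift
    (AddMonoidHom.mk' (fun x => AddMonoidHom.mk'
        (fun p => ((mk _ _ φ).pairHom x).comp (X.contractLeftHom (n + 1) p))
        (fun p p' => by rw [map_add]; ext y; simp))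
      (fun x x' => by ext p y; simp))
    (fun x r p => AddMonoidHom.ext fun y => by
      change (mk _ _ φ).pair ((X.P.tpow (n + 1)).rsmul r x) ((X.contractLeft p (n + 1)).toAddHom y)
        = (mk _ _ φ).pair x ((X.contractLeft (X.P.lsmul r p) (n + 1)).toAddHom y)
      rw [contractLeft_lsmul]
      exact (mk _ _ φ).pair_balanced r x _)

/-- The bimodule homomorphisms `ψ_n : P^{⊗n} ⊗ Q^{⊗n} → R`: `ψ_0 (r ⊗ s) = r s`, `ψ_1 = ψ` and
`ψ_{n+1} ((x ⊗ p) ⊗ (q ⊗ y)) = ψ_n (x ⊗ ψ(p ⊗ q) y)`. -/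
def psi (X : RSystem R) :
    (n : ℕ) → BimoduleHom ((X.P.tpow n).tensor (X.Q.tpow n)) (regular R)
  | 0 => (ofBalanced (regular R) (regular R) (AddMonoidHom.mul (R := R))
      (fun (m r n : R) => mul_assoc m r n) (fun (r m n : R) => mul_assoc r m n)
      (fun (r m n : R) => (mul_assoc m n r).symm)).ψ
  | 1 => X.ψ
  | n + 2 => (ofBalanced (X.P.tpow (n + 2)) (X.Q.tpow (n + 2)) (X.stepHom n (X.psi (n + 1)))
      (fun z r y => DFunLike.congr_fun (tensor_ext
        (f := ((X.stepHom n (X.psi (n + 1))).flip y).comp ((X.P.tpow (n + 2)).rsmul r))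
        (g := (X.stepHom n (X.psi (n + 1))).flip ((X.Q.tpow (n + 2)).lsmul r y))
        (fun x p => congrArg ((mk _ _ (X.psi (n + 1))).pair x)
          (DFunLike.congr_fun (X.contractLeft_rsmul r p (n + 1)) y))) z)
      (fun r z y => DFunLike.congr_fun (tensor_ext
        (f := ((X.stepHom n (X.psi (n + 1))).flip y).comp ((X.P.tpow (n + 2)).lsmul r))
        (g := (AddMonoidHom.mulLeft r).comp ((X.stepHom n (X.psi (n + 1))).flip y))
        (fun x _ => (mk _ _ (X.psi (n + 1))).pair_lsmul r x _)) z)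
      (fun r z y => DFunLike.congr_fun (tensor_ext
        (f := (X.stepHom n (X.psi (n + 1))).flip ((X.Q.tpow (n + 2)).rsmul r y))
        (g := (AddMonoidHom.mulRight r).comp ((X.stepHom n (X.psi (n + 1))).flip y))
        (fun x p => (congrArg ((mk _ _ (X.psi (n + 1))).pair x)
          ((X.contractLeft p (n + 1)).map_rsmul r y)).trans
            ((mk _ _ (X.psi (n + 1))).pair_rsmul r x _))) z)).ψ

/-- The `R`-system `(P^{⊗n}, Q^{⊗n}, ψ_n)`. -/
abbrev power (X : RSystem R) (n : ℕ) : RSystem R := ⟨X.P.tpow n, X.Q.tpow n, X.psi n⟩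

theorem power_pair_zero (X : RSystem R) (r s : R) : (X.power 0).pair r s = r * s := rfl

/-- `V_p` is adjoint to `S_p`. -/
theorem power_pair_tensorRight (X : RSystem R) (p : X.P.carrier) : ∀ (n : ℕ)
    (x : (X.P.tpow n).carrier) (y : (X.Q.tpow (n + 1)).carrier),
    (X.power (n + 1)).pair ((X.P.tensorRight p n).toAddHom x) y
      = (X.power n).pair x ((X.contractLeft p n).toAddHom y)
  | 0, x, y => X.pair_lsmul x p y
  | _ + 1, _, _ => rfl

/-- `S_p T_q` is multiplication by `ψ(p ⊗ q)`. -/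
theorem contractLeft_tensorLeft (X : RSystem R) (p : X.P.carrier) (q : X.Q.carrier) :
    ∀ n : ℕ, (X.contractLeft p n).toAddHom.comp (X.Q.tensorLeft q n).toAddHom
      = (X.Q.tpow n).lsmul (X.pair p q)
  | 0 => AddMonoidHom.ext fun r => X.pair_rsmul r p q
  | 1 => rfl
  | n + 2 => tensor_ext fun x q' =>
      congrArg (fun z => tmul _ X.Q z q')
        (DFunLike.congr_fun (contractLeft_tensorLeft X p q (n + 1)) x)

/-- `U_q` is adjoint to `T_q`. -/
theorem power_pair_tensorLeft (X : RSystem R) (q : X.Q.carrier) : ∀ (n : ℕ)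
    (x : (X.P.tpow (n + 1)).carrier) (y : (X.Q.tpow n).carrier),
    (X.power (n + 1)).pair x ((X.Q.tensorLeft q n).toAddHom y)
      = (X.power n).pair ((X.contractRight q n).toAddHom x) y
  | 0, x, y => X.pair_rsmul y x q
  | n + 1, z, y => DFunLike.congr_fun (tensor_ext
      (f := (X.power (n + 2)).pairHom.flip ((X.Q.tensorLeft q (n + 1)).toAddHom y))
      (g := ((X.power (n + 1)).pairHom.flip y).comp (X.contractRight q (n + 1)).toAddHom)
      (fun x p => (congrArg ((X.power (n + 1)).pair x)
        (DFunLike.congr_fun (X.contractLeft_tensorLeft p q (n + 1)) y)).trans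
          ((X.power (n + 1)).pair_balanced (X.pair p q) x y).symm)) z

/-- The recursion `ψ_{n+1} ((p ⊗ x) ⊗ (y ⊗ q)) = ψ (p ψ_n(x ⊗ y) ⊗ q)`. -/
theorem power_pair_succ (X : RSystem R) (p : X.P.carrier) (q : X.Q.carrier) : ∀ (n : ℕ)
    (x : (X.P.tpow (n + 1)).carrier) (y : (X.Q.tpow (n + 1)).carrier),
    (X.power (n + 2)).pair ((X.P.tensorLeft p (n + 1)).toAddHom x)
        ((X.Q.tensorRight q (n + 1)).toAddHom y)
      = X.pair (X.P.rsmul ((X.power (n + 1)).pair x y) p) q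
  | 0, x, y => (X.pair_balanced (X.pair x y) p q).symm
  | n + 1, z, y => DFunLike.congr_fun (tensor_ext
      (f := ((X.power (n + 3)).pairHom.flip ((X.Q.tensorRight q (n + 2)).toAddHom y)).comp
        (X.P.tensorLeft p (n + 2)).toAddHom)
      (g := ((X.pairHom.flip q).comp (X.P.rsmul.flip p)).comp
        ((X.power (n + 2)).pairHom.flip y))
      (fun x p' => power_pair_succ X p q n x ((X.contractLeft p' (n + 1)).toAddHom y))) z

/-! ### Adjointable and finite rank homomorphisms, condition (FS) -/

/-- The ring `𝓛_P(Q)` of right linear endomorphisms of `Q` having an adjoint with respect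
to `ψ`. -/
def adjointable (X : RSystem R) : NonUnitalSubring (AddMonoid.End X.Q.carrier) where
  carrier := {T | (∀ r q, T (X.Q.rsmul r q) = X.Q.rsmul r (T q)) ∧
    ∃ S : LeftHom X.P X.P, ∀ p q, X.pair p (T q) = X.pair (S.toAddHom p) q}
  zero_mem' := ⟨fun r q => (map_zero _).symm, ⟨0, fun r p => (map_zero _).symm⟩, fun p q =>
    (map_zero (X.pairHom p)).trans (DFunLike.congr_fun (map_zero X.pairHom) q).symm⟩
  add_mem' := by
    rintro T T' ⟨h, S, hS⟩ ⟨h', S', hS'⟩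
    refine ⟨fun r q => ?_, ⟨S.toAddHom + S'.toAddHom, fun r p => by
      simp [S.map_lsmul, S'.map_lsmul]⟩, fun p q => ?_⟩
    · exact (congrArg₂ (· + ·) (h r q) (h' r q)).trans (map_add _ _ _).symm
    · exact (map_add (X.pairHom p) (T q) (T' q)).trans
        ((congrArg₂ (· + ·) (hS p q) (hS' p q)).trans
          (map_add (X.pairHom.flip q) (S.toAddHom p) (S'.toAddHom p)).symm)
  neg_mem' := by
    rintro T ⟨h, S, hS⟩
    refine ⟨fun r q => ?_, ⟨-S.toAddHom, fun r p => by simp [S.map_lsmul]⟩, fun p q => ?_⟩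
    · exact (congrArg Neg.neg (h r q)).trans (map_neg _ _).symm
    · exact (map_neg (X.pairHom p) (T q)).trans
        ((congrArg Neg.neg (hS p q)).trans (map_neg (X.pairHom.flip q) (S.toAddHom p)).symm)
  mul_mem' := by
    rintro T T' ⟨h, S, hS⟩ ⟨h', S', hS'⟩
    exact ⟨fun r q => (congrArg T (h' r q)).trans (h r (T' q)),
      ⟨S'.toAddHom.comp S.toAddHom, fun r p => by simp [S.map_lsmul, S'.map_lsmul]⟩,
      fun p q => (hS p (T' q)).trans (hS' (S.toAddHom p) q)⟩

/-- `θ_{q,p} : Q → Q`, `x ↦ q ψ(p ⊗ x)`. -/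
def rankOne (X : RSystem R) (q : X.Q.carrier) (p : X.P.carrier) : AddMonoid.End X.Q.carrier :=
  (X.Q.rsmul.flip q).comp (X.pairHom p)

/-- `θ_{p,q} : P → P`, `y ↦ ψ(y ⊗ q) p`. -/
def rankOneAdj (X : RSystem R) (p : X.P.carrier) (q : X.Q.carrier) : AddMonoid.End X.P.carrier :=
  (X.P.lsmul.flip p).comp (X.pairHom.flip q)

/-- `𝓕_P(Q)`, the additive span of the `θ_{q,p}`. -/
def finiteRank (X : RSystem R) : AddSubgroup (AddMonoid.End X.Q.carrier) :=
  AddSubgroup.closure {T | ∃ q p, T = X.rankOne q p}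

/-- `𝓕_Q(P)`, the additive span of the `θ_{p,q}`. -/
def finiteRankAdj (X : RSystem R) : AddSubgroup (AddMonoid.End X.P.carrier) :=
  AddSubgroup.closure {T | ∃ p q, T = X.rankOneAdj p q}

/-- Condition (FS). -/
def FS (X : RSystem R) : Prop :=
  ∀ (s : Finset X.Q.carrier) (t : Finset X.P.carrier),
    ∃ Θ ∈ X.finiteRank, ∃ Δ ∈ X.finiteRankAdj, (∀ q ∈ s, Θ q = q) ∧ ∀ p ∈ t, Δ p = p

end RSystem

/-! ### Covariant representations -/

/-- A covariant representation `(S, T, σ, B)` of an `R`-system on the ring `B`. -/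
structure CovariantRep {R : Type u} [NonUnitalRing R] (X : RSystem R)
    (B : Type v) [NonUnitalRing B] where
  S : X.P.carrier →+ B
  T : X.Q.carrier →+ B
  σ : R →ₙ+* B
  S_rsmul : ∀ p r, S (X.P.rsmul r p) = S p * σ r
  S_lsmul : ∀ p r, S (X.P.lsmul r p) = σ r * S p
  T_rsmul : ∀ q r, T (X.Q.rsmul r q) = T q * σ r
  T_lsmul : ∀ q r, T (X.Q.lsmul r q) = σ r * T q
  σ_pair : ∀ p q, σ (X.pair p q) = S p * T q

namespace CovariantRep

variable {R : Type u} [NonUnitalRing R] {X : RSystem R}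

/-- The set `σ(R) ∪ T(Q) ∪ S(P)`. -/
def generators {B : Type v} [NonUnitalRing B] (ρ : CovariantRep X B) : Set B :=
  Set.range ρ.σ ∪ Set.range ρ.T ∪ Set.range ρ.S

/-- `B` is generated as a ring by `σ(R) ∪ T(Q) ∪ S(P)`. -/
def IsSurjective {B : Type v} [NonUnitalRing B] (ρ : CovariantRep X B) : Prop :=
  NonUnitalSubring.closure ρ.generators = ⊤

/-- A ring isomorphism that intertwines the two covariant representations. -/
structure Iso {B : Type v} {C : Type w} [NonUnitalRing B] [NonUnitalRing C]
    (ρ : CovariantRep X B) (τ : CovariantRep X C) where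
  toRingEquiv : B ≃+* C
  map_S : ∀ p, toRingEquiv (ρ.S p) = τ.S p
  map_T : ∀ q, toRingEquiv (ρ.T q) = τ.T q
  map_σ : ∀ r, toRingEquiv (ρ.σ r) = τ.σ r

end CovariantRep

/-! ### The Fock space representation -/

noncomputable section

/-- The inclusion of `M^{⊗n}` into `F(M)`. -/
def RingBimodule.incl {R : Type u} [NonUnitalRing R] (M : RingBimodule R) (n : ℕ) :
    (M.tpow n).carrier →+ M.fock.carrier :=
  DirectSum.of (fun n => (M.tpow n).carrier) n

/-- The projection of `F(M)` onto `M^{⊗n}`. -/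
def RingBimodule.proj {R : Type u} [NonUnitalRing R] (M : RingBimodule R) (n : ℕ) :
    M.fock.carrier →+ (M.tpow n).carrier :=
  DFinsupp.evalAddMonoidHom (β := fun n => (M.tpow n).carrier) n

namespace RSystem

open RingBimodule

variable {R : Type u} [NonUnitalRing R]

theorem fock_ext {M : RingBimodule R} {A : Type*} [AddCommGroup A] {f g : M.fock.carrier →+ A}
    (h : ∀ n x, f (M.incl n x) = g (M.incl n x)) : f = g :=
  DirectSum.addHom_ext (β := fun n => (M.tpow n).carrier) h

theorem proj_incl_same (M : RingBimodule R) (n : ℕ) (x : (M.tpow n).carrier) :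
    M.proj n (M.incl n x) = x :=
  DirectSum.of_eq_same (β := fun n => (M.tpow n).carrier) n x

theorem proj_incl_ne (M : RingBimodule R) {m n : ℕ} (h : m ≠ n) (x : (M.tpow m).carrier) :
    M.proj n (M.incl m x) = 0 :=
  DirectSum.of_eq_of_ne (β := fun n => (M.tpow n).carrier) m n x h.symm

theorem fock_lsmul_incl (M : RingBimodule R) (r : R) (n : ℕ) (x : (M.tpow n).carrier) :
    M.fock.lsmul r (M.incl n x) = M.incl n ((M.tpow n).lsmul r x) :=
  DirectSum.map_of (fun n => (M.tpow n).lsmul r) n x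

theorem fock_rsmul_incl (M : RingBimodule R) (r : R) (n : ℕ) (x : (M.tpow n).carrier) :
    M.fock.rsmul r (M.incl n x) = M.incl n ((M.tpow n).rsmul r x) :=
  DirectSum.map_of (fun n => (M.tpow n).rsmul r) n x

theorem fock_lsmul_proj (M : RingBimodule R) (r : R) (n : ℕ) (x : M.fock.carrier) :
    M.proj n (M.fock.lsmul r x) = (M.tpow n).lsmul r (M.proj n x) :=
  DirectSum.map_apply (fun n => (M.tpow n).lsmul r) n x

theorem fock_rsmul_proj (M : RingBimodule R) (r : R) (n : ℕ) (x : M.fock.carrier) :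
    M.proj n (M.fock.rsmul r x) = (M.tpow n).rsmul r (M.proj n x) :=
  DirectSum.map_apply (fun n => (M.tpow n).rsmul r) n x

/-- The pairing `⟨x, y⟩ = ∑ₙ ψ_n (x_n ⊗ y_n)` of `F(P)` and `F(Q)`. -/
def fockPairing (X : RSystem R) : X.P.fock.carrier →+ X.Q.fock.carrier →+ R :=
  DirectSum.toAddMonoid (β := fun n => (X.P.tpow n).carrier) fun n =>
    AddMonoidHom.mk' (fun x => ((X.power n).pairHom x).comp (X.Q.proj n))
      (fun x x' => AddMonoidHom.ext fun y =>
        DFunLike.congr_fun (map_add (X.power n).pairHom x x') (X.Q.proj n y))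

theorem fockPairing_incl (X : RSystem R) (n : ℕ) (x : (X.P.tpow n).carrier)
    (y : X.Q.fock.carrier) :
    X.fockPairing (X.P.incl n x) y = (X.power n).pair x (X.Q.proj n y) :=
  DFunLike.congr_fun (DirectSum.toAddMonoid_of (β := fun n => (X.P.tpow n).carrier) _ n x) y

/-- The `R`-system `(F(P), F(Q), ⟨·,·⟩)`. -/
def fockSystem (X : RSystem R) : RSystem R :=
  ofBalanced X.P.fock X.Q.fock X.fockPairing
    (fun x r y => DFunLike.congr_fun (fock_ext (M := X.P)
      (f := (X.fockPairing.flip y).comp (X.P.fock.rsmul r))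
      (g := X.fockPairing.flip (X.Q.fock.lsmul r y)) (fun n x => by
        change X.fockPairing (X.P.fock.rsmul r (X.P.incl n x)) y
          = X.fockPairing (X.P.incl n x) (X.Q.fock.lsmul r y)
        rw [fock_rsmul_incl, fockPairing_incl, fockPairing_incl, fock_lsmul_proj]
        exact (X.power n).pair_balanced r x _)) x)
    (fun r x y => DFunLike.congr_fun (fock_ext (M := X.P)
      (f := (X.fockPairing.flip y).comp (X.P.fock.lsmul r))
      (g := (AddMonoidHom.mulLeft r).comp (X.fockPairing.flip y)) (fun n x => by
        change X.fockPairing (X.P.fock.lsmul r (X.P.incl n x)) y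
          = r * X.fockPairing (X.P.incl n x) y
        rw [fock_lsmul_incl, fockPairing_incl, fockPairing_incl]
        exact (X.power n).pair_lsmul r x _)) x)
    (fun r x y => DFunLike.congr_fun (fock_ext (M := X.P)
      (f := X.fockPairing.flip (X.Q.fock.rsmul r y))
      (g := (AddMonoidHom.mulRight r).comp (X.fockPairing.flip y)) (fun n x => by
        change X.fockPairing (X.P.incl n x) (X.Q.fock.rsmul r y)
          = X.fockPairing (X.P.incl n x) y * r
        rw [fockPairing_incl, fockPairing_incl, fock_rsmul_proj]
        exact (X.power n).pair_rsmul r x _)) x)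

/-- Homogeneous map of degree `1`: `{x_0, x_1, …} ↦ {0, f₀ x₀, f₁ x₁, …}`. -/
def shiftUp {M : RingBimodule R} (f : ∀ n, (M.tpow n).carrier →+ (M.tpow (n + 1)).carrier) :
    AddMonoid.End M.fock.carrier :=
  DirectSum.toAddMonoid (β := fun n => (M.tpow n).carrier) fun n => (M.incl (n + 1)).comp (f n)

/-- Homogeneous map of degree `-1`: `{x_0, x_1, …} ↦ {f₀ x₁, f₁ x₂, …}`. -/
def shiftDown {M : RingBimodule R} (f : ∀ n, (M.tpow (n + 1)).carrier →+ (M.tpow n).carrier) :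
    AddMonoid.End M.fock.carrier :=
  DirectSum.toAddMonoid (β := fun n => (M.tpow n).carrier) fun
    | 0 => 0
    | n + 1 => (M.incl n).comp (f n)

theorem shiftUp_incl {M : RingBimodule R}
    (f : ∀ n, (M.tpow n).carrier →+ (M.tpow (n + 1)).carrier) (n : ℕ) (x : (M.tpow n).carrier) :
    shiftUp f (M.incl n x) = M.incl (n + 1) (f n x) :=
  DirectSum.toAddMonoid_of (β := fun n => (M.tpow n).carrier) _ n x

theorem shiftDown_incl_zero {M : RingBimodule R}
    (f : ∀ n, (M.tpow (n + 1)).carrier →+ (M.tpow n).carrier) (x : (M.tpow 0).carrier) :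
    shiftDown f (M.incl 0 x) = 0 :=
  DirectSum.toAddMonoid_of (β := fun n => (M.tpow n).carrier) _ 0 x

theorem shiftDown_incl_succ {M : RingBimodule R}
    (f : ∀ n, (M.tpow (n + 1)).carrier →+ (M.tpow n).carrier) (n : ℕ)
    (x : (M.tpow (n + 1)).carrier) :
    shiftDown f (M.incl (n + 1) x) = M.incl n (f n x) :=
  DirectSum.toAddMonoid_of (β := fun n => (M.tpow n).carrier) _ (n + 1) x

theorem shiftUp_proj_zero {M : RingBimodule R}
    (f : ∀ n, (M.tpow n).carrier →+ (M.tpow (n + 1)).carrier) (y : M.fock.carrier) :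
    M.proj 0 (shiftUp f y) = 0 :=
  DFunLike.congr_fun (fock_ext (M := M) (f := (M.proj 0).comp (shiftUp f)) (g := 0)
    fun n x => by
      change M.proj 0 (shiftUp f (M.incl n x)) = 0
      rw [shiftUp_incl, proj_incl_ne _ (by omega)]) y

theorem shiftUp_proj_succ {M : RingBimodule R}
    (f : ∀ n, (M.tpow n).carrier →+ (M.tpow (n + 1)).carrier) (y : M.fock.carrier) (n : ℕ) :
    M.proj (n + 1) (shiftUp f y) = f n (M.proj n y) :=
  DFunLike.congr_fun (fock_ext (M := M) (f := (M.proj (n + 1)).comp (shiftUp f))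
    (g := (f n).comp (M.proj n)) fun m x => by
      change M.proj (n + 1) (shiftUp f (M.incl m x)) = f n (M.proj n (M.incl m x))
      rw [shiftUp_incl]
      by_cases h : m = n
      · subst h
        rw [proj_incl_same, proj_incl_same]
      · rw [proj_incl_ne _ (by omega), proj_incl_ne _ h, map_zero]) y

theorem shiftDown_proj {M : RingBimodule R}
    (f : ∀ n, (M.tpow (n + 1)).carrier →+ (M.tpow n).carrier) (y : M.fock.carrier) (n : ℕ) :
    M.proj n (shiftDown f y) = f n (M.proj (n + 1) y) :=
  DFunLike.congr_fun (fock_ext (M := M) (f := (M.proj n).comp (shiftDown f))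
    (g := (f n).comp (M.proj (n + 1))) fun m x => by
      change M.proj n (shiftDown f (M.incl m x)) = f n (M.proj (n + 1) (M.incl m x))
      cases m with
      | zero => rw [shiftDown_incl_zero, proj_incl_ne _ (by omega), map_zero, map_zero]
      | succ m =>
        rw [shiftDown_incl_succ]
        by_cases h : m = n
        · subst h
          rw [proj_incl_same, proj_incl_same]
        · rw [proj_incl_ne _ h, proj_incl_ne _ (by omega), map_zero]) y

/-- The creation homomorphism `T_q` of `F(Q)`. -/
def creation (X : RSystem R) (q : X.Q.carrier) : AddMonoid.End X.Q.fock.carrier :=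
  shiftUp fun n => (X.Q.tensorLeft q n).toAddHom

/-- The annihilation homomorphism `S_p` of `F(Q)`. -/
def annihilation (X : RSystem R) (p : X.P.carrier) : AddMonoid.End X.Q.fock.carrier :=
  shiftDown fun n => (X.contractLeft p n).toAddHom

/-- The diagonal homomorphism `φ_∞(r)` of `F(Q)`: left multiplication by `r`. -/
def diagonal (X : RSystem R) (r : R) : AddMonoid.End X.Q.fock.carrier := X.Q.fock.lsmul r

theorem creation_mem (X : RSystem R) (q : X.Q.carrier) :
    X.creation q ∈ X.fockSystem.adjointable := by
  refine ⟨fun r y => DFunLike.congr_fun (fock_ext (M := X.Q)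
      (f := (X.creation q).comp (X.Q.fock.rsmul r))
      (g := (X.Q.fock.rsmul r).comp (X.creation q)) fun n x => ?_) y,
    ⟨shiftDown fun n => (X.contractRight q n).toAddHom, fun r y => DFunLike.congr_fun
      (fock_ext (M := X.P)
        (f := (shiftDown fun n => (X.contractRight q n).toAddHom).comp (X.P.fock.lsmul r))
        (g := (X.P.fock.lsmul r).comp (shiftDown fun n => (X.contractRight q n).toAddHom))
        fun n x => ?_) y⟩,
    fun (x : X.P.fock.carrier) (y : X.Q.fock.carrier) => DFunLike.congr_fun (fock_ext (M := X.P)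
      (f := X.fockPairing.flip (X.creation q y))
      (g := (X.fockPairing.flip y).comp (shiftDown fun n => (X.contractRight q n).toAddHom))
      fun n x => ?_) x⟩
  · change X.creation q (X.Q.fock.rsmul r (X.Q.incl n x)) = X.Q.fock.rsmul r (X.creation q (X.Q.incl n x))
    rw [fock_rsmul_incl, creation, shiftUp_incl, shiftUp_incl, fock_rsmul_incl,
      (X.Q.tensorLeft q n).map_rsmul]
  · change shiftDown (fun n => (X.contractRight q n).toAddHom) (X.P.fock.lsmul r (X.P.incl n x))
      = X.P.fock.lsmul r (shiftDown (fun n => (X.contractRight q n).toAddHom) (X.P.incl n x))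
    rw [fock_lsmul_incl]
    cases n with
    | zero => rw [shiftDown_incl_zero, shiftDown_incl_zero, map_zero]
    | succ n =>
      rw [shiftDown_incl_succ, shiftDown_incl_succ, fock_lsmul_incl, (X.contractRight q n).map_lsmul]
  · change X.fockPairing (X.P.incl n x) (X.creation q y) = X.fockPairing
      (shiftDown (fun n => (X.contractRight q n).toAddHom) (X.P.incl n x)) y
    rw [fockPairing_incl, creation]
    cases n with
    | zero =>
      rw [shiftDown_incl_zero, map_zero, shiftUp_proj_zero]
      exact map_zero ((X.power 0).pairHom x)
    | succ n =>
      rw [shiftDown_incl_succ, fockPairing_incl, shiftUp_proj_succ]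
      exact X.power_pair_tensorLeft q n x _

theorem annihilation_mem (X : RSystem R) (p : X.P.carrier) :
    X.annihilation p ∈ X.fockSystem.adjointable := by
  refine ⟨fun r y => DFunLike.congr_fun (fock_ext (M := X.Q)
      (f := (X.annihilation p).comp (X.Q.fock.rsmul r))
      (g := (X.Q.fock.rsmul r).comp (X.annihilation p)) fun n x => ?_) y,
    ⟨shiftUp fun n => (X.P.tensorRight p n).toAddHom, fun r y => DFunLike.congr_fun
      (fock_ext (M := X.P)
        (f := (shiftUp fun n => (X.P.tensorRight p n).toAddHom).comp (X.P.fock.lsmul r))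
        (g := (X.P.fock.lsmul r).comp (shiftUp fun n => (X.P.tensorRight p n).toAddHom))
        fun n x => ?_) y⟩,
    fun (x : X.P.fock.carrier) (y : X.Q.fock.carrier) => DFunLike.congr_fun (fock_ext (M := X.P)
      (f := X.fockPairing.flip (X.annihilation p y))
      (g := (X.fockPairing.flip y).comp (shiftUp fun n => (X.P.tensorRight p n).toAddHom))
      fun n x => ?_) x⟩
  · change X.annihilation p (X.Q.fock.rsmul r (X.Q.incl n x)) = X.Q.fock.rsmul r (X.annihilation p (X.Q.incl n x))
    rw [fock_rsmul_incl, annihilation]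
    cases n with
    | zero => rw [shiftDown_incl_zero, shiftDown_incl_zero, map_zero]
    | succ n =>
      rw [shiftDown_incl_succ, shiftDown_incl_succ, fock_rsmul_incl, (X.contractLeft p n).map_rsmul]
  · change shiftUp (fun n => (X.P.tensorRight p n).toAddHom) (X.P.fock.lsmul r (X.P.incl n x))
      = X.P.fock.lsmul r (shiftUp (fun n => (X.P.tensorRight p n).toAddHom) (X.P.incl n x))
    rw [fock_lsmul_incl, shiftUp_incl, shiftUp_incl, fock_lsmul_incl, (X.P.tensorRight p n).map_lsmul]
  · change X.fockPairing (X.P.incl n x) (X.annihilation p y) = X.fockPairing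
      (shiftUp (fun n => (X.P.tensorRight p n).toAddHom) (X.P.incl n x)) y
    rw [fockPairing_incl, annihilation, shiftUp_incl, shiftDown_proj, fockPairing_incl]
    exact (X.power_pair_tensorRight p n x _).symm

theorem diagonal_mem (X : RSystem R) (r : R) : X.diagonal r ∈ X.fockSystem.adjointable :=
  ⟨fun s y => X.Q.fock.lsmul_rsmul r s y, rsmulHom X.P.fock r, fun x y =>
    (X.fockSystem.pair_balanced r x y).symm⟩

/-- `T_𝓕 : Q → 𝓛_{F(P)}(F(Q))`, `q ↦ T_q`. -/
def fockT (X : RSystem R) : X.Q.carrier →+ X.fockSystem.adjointable :=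
  AddMonoidHom.mk' (fun q => ⟨X.creation q, X.creation_mem q⟩) (fun q q' => Subtype.ext
    (fock_ext (M := X.Q) fun n x => by
      change X.creation (q + q') (X.Q.incl n x)
        = X.creation q (X.Q.incl n x) + X.creation q' (X.Q.incl n x)
      rw [creation, creation, creation, shiftUp_incl, shiftUp_incl, shiftUp_incl, ← map_add, tensorLeft_add]
      rfl))

/-- `S_𝓕 : P → 𝓛_{F(P)}(F(Q))`, `p ↦ S_p`. -/
def fockS (X : RSystem R) : X.P.carrier →+ X.fockSystem.adjointable :=
  AddMonoidHom.mk' (fun p => ⟨X.annihilation p, X.annihilation_mem p⟩) (fun p p' => Subtype.ext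
    (fock_ext (M := X.Q) fun n x => by
      change X.annihilation (p + p') (X.Q.incl n x)
        = X.annihilation p (X.Q.incl n x) + X.annihilation p' (X.Q.incl n x)
      rw [annihilation, annihilation, annihilation]
      cases n with
      | zero => rw [shiftDown_incl_zero, shiftDown_incl_zero, shiftDown_incl_zero, add_zero]
      | succ n =>
        rw [shiftDown_incl_succ, shiftDown_incl_succ, shiftDown_incl_succ, ← map_add, contractLeft_add]
        rfl))

/-- `σ_𝓕 : R → 𝓛_{F(P)}(F(Q))`, `r ↦ φ_∞(r)`. -/
def fockσ (X : RSystem R) : R →ₙ+* X.fockSystem.adjointable where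
  toFun r := ⟨X.diagonal r, X.diagonal_mem r⟩
  map_mul' r s := Subtype.ext (AddMonoidHom.ext fun y => X.Q.fock.mul_lsmul r s y)
  map_zero' := Subtype.ext (map_zero X.Q.fock.lsmul)
  map_add' r s := Subtype.ext (map_add X.Q.fock.lsmul r s)

/-- The ring `𝓕_{(P,Q,ψ)}`: the subring of `𝓛_{F(P)}(F(Q))` generated by
`T_𝓕(Q) ∪ S_𝓕(P) ∪ σ_𝓕(R)`. -/
def fockRing (X : RSystem R) : NonUnitalSubring X.fockSystem.adjointable :=
  NonUnitalSubring.closure (Set.range X.fockT ∪ Set.range X.fockS ∪ Set.range X.fockσ)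

theorem fockT_mem (X : RSystem R) (q : X.Q.carrier) : X.fockT q ∈ X.fockRing :=
  NonUnitalSubring.subset_closure (Or.inl (Or.inl ⟨q, rfl⟩))

theorem fockS_mem (X : RSystem R) (p : X.P.carrier) : X.fockS p ∈ X.fockRing :=
  NonUnitalSubring.subset_closure (Or.inl (Or.inr ⟨p, rfl⟩))

theorem fockσ_mem (X : RSystem R) (r : R) : X.fockσ r ∈ X.fockRing :=
  NonUnitalSubring.subset_closure (Or.inr ⟨r, rfl⟩)

/-- The Fock space representation `(S_𝓕, T_𝓕, σ_𝓕, 𝓕_{(P,Q,ψ)})`. -/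
def fockRep (X : RSystem R) : CovariantRep X X.fockRing where
  S := AddMonoidHom.mk' (fun p => ⟨X.fockS p, X.fockS_mem p⟩)
    (fun p p' => Subtype.ext (map_add X.fockS p p'))
  T := AddMonoidHom.mk' (fun q => ⟨X.fockT q, X.fockT_mem q⟩)
    (fun q q' => Subtype.ext (map_add X.fockT q q'))
  σ :=
    { toFun := fun r => ⟨X.fockσ r, X.fockσ_mem r⟩
      map_mul' := fun r s => Subtype.ext (map_mul X.fockσ r s)
      map_zero' := Subtype.ext (map_zero X.fockσ)
      map_add' := fun r s => Subtype.ext (map_add X.fockσ r s) }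
  S_rsmul p r := Subtype.ext (Subtype.ext (fock_ext (M := X.Q) fun n x => by
    change X.annihilation (X.P.rsmul r p) (X.Q.incl n x)
      = X.annihilation p (X.Q.fock.lsmul r (X.Q.incl n x))
    rw [annihilation, annihilation, fock_lsmul_incl]
    cases n with
    | zero => rw [shiftDown_incl_zero, shiftDown_incl_zero]
    | succ n =>
      rw [shiftDown_incl_succ, shiftDown_incl_succ, contractLeft_rsmul]
      rfl))
  S_lsmul p r := Subtype.ext (Subtype.ext (fock_ext (M := X.Q) fun n x => by
    change X.annihilation (X.P.lsmul r p) (X.Q.incl n x)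
      = X.Q.fock.lsmul r (X.annihilation p (X.Q.incl n x))
    rw [annihilation, annihilation]
    cases n with
    | zero => rw [shiftDown_incl_zero, shiftDown_incl_zero, map_zero]
    | succ n =>
      rw [shiftDown_incl_succ, shiftDown_incl_succ, contractLeft_lsmul, fock_lsmul_incl]
      rfl))
  T_rsmul q r := Subtype.ext (Subtype.ext (fock_ext (M := X.Q) fun n x => by
    change X.creation (X.Q.rsmul r q) (X.Q.incl n x)
      = X.creation q (X.Q.fock.lsmul r (X.Q.incl n x))
    rw [creation, creation, fock_lsmul_incl, shiftUp_incl, shiftUp_incl]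
    exact congrArg _ (DFunLike.congr_fun (X.Q.tensorLeft_rsmul r q n) x)))
  T_lsmul q r := Subtype.ext (Subtype.ext (fock_ext (M := X.Q) fun n x => by
    change X.creation (X.Q.lsmul r q) (X.Q.incl n x)
      = X.Q.fock.lsmul r (X.creation q (X.Q.incl n x))
    rw [creation, creation, shiftUp_incl, shiftUp_incl, fock_lsmul_incl]
    exact congrArg _ (DFunLike.congr_fun (X.Q.tensorLeft_lsmul r q n) x)))
  σ_pair p q := Subtype.ext (Subtype.ext (fock_ext (M := X.Q) fun n x => by
    change X.Q.fock.lsmul (X.pair p q) (X.Q.incl n x)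
      = X.annihilation p (X.creation q (X.Q.incl n x))
    rw [annihilation, creation, shiftUp_incl, shiftDown_incl_succ, fock_lsmul_incl]
    exact congrArg _ (DFunLike.congr_fun (X.contractLeft_tensorLeft p q n) x).symm))

theorem fockRep_isSurjective (X : RSystem R) : X.fockRep.IsSurjective := by
  refine eq_top_iff.2 fun ⟨x, hx⟩ _ => ?_
  refine NonUnitalSubring.closure_induction (p := fun x hx =>
    (⟨x, hx⟩ : X.fockRing) ∈ NonUnitalSubring.closure X.fockRep.generators)
    ?_ ?_ ?_ ?_ ?_ hx
  · rintro _ ((⟨q, rfl⟩ | ⟨p, rfl⟩) | ⟨r, rfl⟩)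
    · exact NonUnitalSubring.subset_closure (Or.inl (Or.inr ⟨q, rfl⟩))
    · exact NonUnitalSubring.subset_closure (Or.inr ⟨p, rfl⟩)
    · exact NonUnitalSubring.subset_closure (Or.inl (Or.inl ⟨r, rfl⟩))
  · exact zero_mem _
  · exact fun _ _ _ _ h h' => add_mem h h'
  · exact fun _ _ h => neg_mem h
  · exact fun _ _ _ _ h h' => mul_mem h h'

/-! ### The Toeplitz representation -/

/-- The free non-unital ring on the symbols `[p]`, `[q]`, `[r]` for `p ∈ P`, `q ∈ Q`, `r ∈ R`. -/
abbrev FreeRing (X : RSystem R) : Type u :=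
  MonoidAlgebra ℤ (FreeSemigroup (X.P.carrier ⊕ X.Q.carrier ⊕ R))

/-- The generator of the free ring belonging to a symbol. -/
def freeGen (X : RSystem R) (z : X.P.carrier ⊕ X.Q.carrier ⊕ R) : X.FreeRing :=
  MonoidAlgebra.ofMagma ℤ _ (FreeSemigroup.of z)

def genP (X : RSystem R) (p : X.P.carrier) : X.FreeRing := X.freeGen (Sum.inl p)

def genQ (X : RSystem R) (q : X.Q.carrier) : X.FreeRing := X.freeGen (Sum.inr (Sum.inl q))

def genR (X : RSystem R) (r : R) : X.FreeRing := X.freeGen (Sum.inr (Sum.inr r))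

/-- The relations of a covariant representation. -/
inductive ToeplitzRel (X : RSystem R) : X.FreeRing → X.FreeRing → Prop
  | P_add (p p' : X.P.carrier) : ToeplitzRel X (X.genP (p + p')) (X.genP p + X.genP p')
  | Q_add (q q' : X.Q.carrier) : ToeplitzRel X (X.genQ (q + q')) (X.genQ q + X.genQ q')
  | R_add (r r' : R) : ToeplitzRel X (X.genR (r + r')) (X.genR r + X.genR r')
  | R_mul (r r' : R) : ToeplitzRel X (X.genR (r * r')) (X.genR r * X.genR r')
  | P_rsmul (p : X.P.carrier) (r : R) :
      ToeplitzRel X (X.genP (X.P.rsmul r p)) (X.genP p * X.genR r)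
  | P_lsmul (p : X.P.carrier) (r : R) :
      ToeplitzRel X (X.genP (X.P.lsmul r p)) (X.genR r * X.genP p)
  | Q_rsmul (q : X.Q.carrier) (r : R) :
      ToeplitzRel X (X.genQ (X.Q.rsmul r q)) (X.genQ q * X.genR r)
  | Q_lsmul (q : X.Q.carrier) (r : R) :
      ToeplitzRel X (X.genQ (X.Q.lsmul r q)) (X.genR r * X.genQ q)
  | pair (p : X.P.carrier) (q : X.Q.carrier) :
      ToeplitzRel X (X.genR (X.pair p q)) (X.genP p * X.genQ q)

/-- The Toeplitz ring `𝓣_{(P,Q,ψ)}`: the universal ring generated by copies of `P`, `Q`, `R`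
subject to the relations of a covariant representation. -/
def ToeplitzRing (X : RSystem R) : Type u := (ringConGen X.ToeplitzRel).Quotient

instance (X : RSystem R) : NonUnitalRing X.ToeplitzRing :=
  inferInstanceAs (NonUnitalRing (ringConGen X.ToeplitzRel).Quotient)

/-- The quotient map onto the Toeplitz ring. -/
def toeplitzMk (X : RSystem R) : X.FreeRing →ₙ+* X.ToeplitzRing where
  toFun a := ((a : (ringConGen X.ToeplitzRel).Quotient) :)
  map_mul' _ _ := rfl
  map_zero' := rfl
  map_add' _ _ := rfl

theorem toeplitzMk_eq (X : RSystem R) {a b : X.FreeRing} (h : X.ToeplitzRel a b) :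
    X.toeplitzMk a = X.toeplitzMk b :=
  (RingCon.eq _).2 (RingCon.le_ringConGen _ _ h)

/-- The Toeplitz representation `(ι_P, ι_Q, ι_R, 𝓣_{(P,Q,ψ)})`. -/
def toeplitzRep (X : RSystem R) : CovariantRep X X.ToeplitzRing where
  S := AddMonoidHom.mk' (fun p => X.toeplitzMk (X.genP p))
    (fun p p' => (X.toeplitzMk_eq (.P_add p p')).trans (map_add _ _ _))
  T := AddMonoidHom.mk' (fun q => X.toeplitzMk (X.genQ q))
    (fun q q' => (X.toeplitzMk_eq (.Q_add q q')).trans (map_add _ _ _))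
  σ :=
    { toFun := fun r => X.toeplitzMk (X.genR r)
      map_mul' := fun r s => (X.toeplitzMk_eq (.R_mul r s)).trans (map_mul _ _ _)
      map_zero' := (AddMonoidHom.mk' (fun r => X.toeplitzMk (X.genR r))
        (fun r s => (X.toeplitzMk_eq (.R_add r s)).trans (map_add _ _ _))).map_zero
      map_add' := fun r s => (X.toeplitzMk_eq (.R_add r s)).trans (map_add _ _ _) }
  S_rsmul p r := (X.toeplitzMk_eq (.P_rsmul p r)).trans (map_mul _ _ _)
  S_lsmul p r := (X.toeplitzMk_eq (.P_lsmul p r)).trans (map_mul _ _ _)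
  T_rsmul q r := (X.toeplitzMk_eq (.Q_rsmul q r)).trans (map_mul _ _ _)
  T_lsmul q r := (X.toeplitzMk_eq (.Q_lsmul q r)).trans (map_mul _ _ _)
  σ_pair p q := (X.toeplitzMk_eq (.pair p q)).trans (map_mul _ _ _)

theorem toeplitzRep_isSurjective (X : RSystem R) : X.toeplitzRep.IsSurjective := by
  refine eq_top_iff.2 fun x hx => ?_
  clear hx
  obtain ⟨a, rfl⟩ : ∃ a, X.toeplitzMk a = x := Quotient.exists_rep x
  induction a using MonoidAlgebra.induction_linear with
  | zero => rw [map_zero]; exact zero_mem _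
  | add a b ha hb => rw [map_add]; exact add_mem ha hb
  | single w k =>
    have hw : MonoidAlgebra.single w k = k • MonoidAlgebra.ofMagma ℤ _ w := by
      simp [MonoidAlgebra.ofMagma]
    rw [hw, map_zsmul]
    refine zsmul_mem ?_ k
    clear hw
    induction w using FreeSemigroup.recOnMul with
    | ih1 z =>
      rcases z with p | q | r
      · exact NonUnitalSubring.subset_closure (Or.inr ⟨p, rfl⟩)
      · exact NonUnitalSubring.subset_closure (Or.inl (Or.inr ⟨q, rfl⟩))
      · exact NonUnitalSubring.subset_closure (Or.inl (Or.inl ⟨r, rfl⟩))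
    | ih2 z w hz hw' =>
      rw [map_mul, map_mul]
      exact mul_mem hz hw'

/-- The universal property of the Toeplitz representation. -/
theorem toeplitzRep_universal (X : RSystem R) {B : Type v} [NonUnitalRing B]
    (ρ : CovariantRep X B) :
    ∃! η : X.ToeplitzRing →ₙ+* B, (∀ r, η (X.toeplitzRep.σ r) = ρ.σ r) ∧
      (∀ q, η (X.toeplitzRep.T q) = ρ.T q) ∧ ∀ p, η (X.toeplitzRep.S p) = ρ.S p := by
  let g : X.P.carrier ⊕ X.Q.carrier ⊕ R → B := Sum.elim ρ.S (Sum.elim ρ.T ρ.σ)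
  let G : X.FreeRing →ₙₐ[ℤ] B := MonoidAlgebra.liftMagma ℤ (FreeSemigroup.lift g)
  have hG : ∀ z, G (X.freeGen z) = g z := fun z => by
    simp [G, freeGen, MonoidAlgebra.ofMagma]
  have hP : ∀ p, G (X.genP p) = ρ.S p := fun p => hG _
  have hQ : ∀ q, G (X.genQ q) = ρ.T q := fun q => hG _
  have hR : ∀ r, G (X.genR r) = ρ.σ r := fun r => hG _
  let c : RingCon X.FreeRing :=
    { r := fun a b => G a = G b
      iseqv := ⟨fun _ => rfl, fun h => h.symm, fun h h' => h.trans h'⟩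
      mul' := fun h h' => by simp only [map_mul] at *; rw [h, h']
      add' := fun h h' => by simp only [map_add] at *; rw [h, h'] }
  have hc : ringConGen X.ToeplitzRel ≤ c := RingCon.ringConGen_le.2 (by
    rintro _ _ (⟨p, p'⟩ | ⟨q, q'⟩ | ⟨r, r'⟩ | ⟨r, r'⟩ | ⟨p, r⟩ | ⟨p, r⟩ | ⟨q, r⟩ | ⟨q, r⟩ | ⟨p, q⟩)
    all_goals change G _ = G _
    all_goals simp only [map_add, map_mul, hP, hQ, hR, ρ.S_rsmul, ρ.S_lsmul, ρ.T_rsmul,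
      ρ.T_lsmul, ρ.σ_pair])
  let η : X.ToeplitzRing →ₙ+* B :=
    { toFun := fun x => Quotient.liftOn x G fun a b h => hc h
      map_mul' := fun x y => Quotient.inductionOn₂ x y fun a b => map_mul G a b
      map_zero' := map_zero G
      map_add' := fun x y => Quotient.inductionOn₂ x y fun a b => map_add G a b }
  refine ⟨η, ⟨fun r => hR r, fun q => hQ q, fun p => hP p⟩, fun η' ⟨h1, h2, h3⟩ => ?_⟩
  refine NonUnitalRingHom.ext fun x => ?_
  have hx : x ∈ NonUnitalSubring.closure X.toeplitzRep.generators := by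
    rw [X.toeplitzRep_isSurjective]; trivial
  induction hx using NonUnitalSubring.closure_induction with
  | mem x hx =>
    rcases hx with (⟨r, rfl⟩ | ⟨q, rfl⟩) | ⟨p, rfl⟩
    · exact (h1 r).trans (hR r).symm
    · exact (h2 q).trans (hQ q).symm
    · exact (h3 p).trans (hP p).symm
  | zero => rw [map_zero, map_zero]
  | add x y _ _ hx hy => rw [map_add, map_add, hx, hy]
  | neg x _ hx => rw [map_neg, map_neg, hx]
  | mul x y _ _ hx hy => rw [map_mul, map_mul, hx, hy]

end RSystem

end

/-! The images of P, Q and R generate the Fock ring, so the homomorphism η which the universal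
property of the Toeplitz ring provides is onto. The content is its injectivity.

The relation S(p)T(q) = σ(ψ(p ⊗ q)) moves every S to the right of every T, so elements of the
Toeplitz ring are sums of words T(q₁)⋯T(qₖ)S(p₁)⋯S(pₗ), with σ(r) in place of the empty T-part. They
are filtered by a bound on l, the number of factors S (`exists_mem_filtration`). Above level 0, an
element is a = T(x) + c, where T(x) is the image of some x in F(Q) under the maps T^n and c is a sum
of elements of the previous level, each multiplied by some S(p) on the right.

Suppose η(a) = 0 and let η(a) act on Q^{⊗0} = R. The part c contributes nothing, since S_p
annihilates degree 0, while T(x) sends r to x r (`fockAction_fockMap_incl_zero`). Hence x R = 0, and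
x = 0 follows (`FS.eq_zero_of_fock_rsmul`): in positive degree, (FS) on Q writes a component as a
sum of qᵢ ⊗ S_{pᵢ}(component), which lowers the degree until right non-degeneracy of R applies.

What remains is a = c. By (FS) on P, c = ∑ c T(qᵢ) S(pᵢ). Each c T(qᵢ) lies one level lower and in
the kernel of η, so it vanishes by induction on the level (`eq_zero_of_mem_filtration`). -/

noncomputable section

namespace RSystem

open RingBimodule

variable {R : Type u} [NonUnitalRing R]

/-! ### Finite rank operators on the tensor powers of Q -/

theorem tensor_induction {M N : RingBimodule R} {C : TensorCarrier M N → Prop}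
    (zero : C 0) (tmul : ∀ m n, C (tmul M N m n)) (add : ∀ x y, C x → C y → C (x + y))
    (z : TensorCarrier M N) : C z := by
  obtain ⟨y, rfl⟩ := QuotientAddGroup.mk'_surjective (balanceSubgroup M N) z
  induction y with
  | zero => exact zero
  | tmul m n => exact tmul m n
  | add a b ha hb => exact add _ _ ha hb

/-- The finite rank endomorphism `x ↦ ∑ qᵢ ⊗ S_{pᵢ} x` of `Q^{⊗(n+1)}` given by a list of pairs
`(qᵢ, pᵢ)`. -/
def rankList (X : RSystem R) (l : List (X.Q.carrier × X.P.carrier)) (n : ℕ) :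
    (X.Q.tpow (n + 1)).carrier →+ (X.Q.tpow (n + 1)).carrier :=
  (l.map fun z => (X.Q.tensorLeft z.1 n).toAddHom.comp (X.contractLeft z.2 n).toAddHom).sum

theorem rankList_cons (X : RSystem R) (z : X.Q.carrier × X.P.carrier)
    (l : List (X.Q.carrier × X.P.carrier)) (n : ℕ) (x : (X.Q.tpow (n + 1)).carrier) :
    X.rankList (z :: l) n x
      = (X.Q.tensorLeft z.1 n).toAddHom ((X.contractLeft z.2 n).toAddHom x)
        + X.rankList l n x := by
  simp [rankList]

theorem rankList_append (X : RSystem R) (l l' : List (X.Q.carrier × X.P.carrier)) (n : ℕ) :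
    X.rankList (l ++ l') n = X.rankList l n + X.rankList l' n := by
  simp [rankList]

/-- Contraction and creation both work at the left end of a tensor, so an extra right factor is
inert. Only in the lowest degree does the scalar ψ(p ⊗ x) have to cross the tensor sign, by
balancing. -/
theorem tensorLeft_contractLeft_tmul (X : RSystem R) (q : X.Q.carrier) (p : X.P.carrier)
    (y : X.Q.carrier) : ∀ (n : ℕ) (x : (X.Q.tpow (n + 1)).carrier),
    (X.Q.tensorLeft q (n + 1)).toAddHom
        ((X.contractLeft p (n + 1)).toAddHom (tmul (X.Q.tpow (n + 1)) X.Q x y))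
      = tmul (X.Q.tpow (n + 1)) X.Q
          ((X.Q.tensorLeft q n).toAddHom ((X.contractLeft p n).toAddHom x)) y
  | 0, x => (tmul_balanced X.Q X.Q q (X.pair p x) y).symm
  | _ + 1, _ => rfl

theorem rankList_tmul (X : RSystem R) (l : List (X.Q.carrier × X.P.carrier)) (n : ℕ)
    (x : (X.Q.tpow (n + 1)).carrier) (y : X.Q.carrier) :
    X.rankList l (n + 1) (tmul (X.Q.tpow (n + 1)) X.Q x y)
      = tmul (X.Q.tpow (n + 1)) X.Q (X.rankList l n x) y := by
  induction l with
  | nil => exact (DFunLike.congr_fun (map_zero (tmul (X.Q.tpow (n + 1)) X.Q)) y).symm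
  | cons z l ih =>
    rw [rankList_cons, map_add, AddMonoidHom.add_apply, ← ih, ← tensorLeft_contractLeft_tmul]
    exact X.rankList_cons z l (n + 1) _

/-- A finite rank operator acts on leftmost factors only, so it fixes x as soon as it fixes the
leftmost factors of the elementary tensors in some expression of x. The finite set is chosen before
the list: sets for two summands can then be united, and one application of (FS) serves all of them.
-/
theorem exists_finset_rankList (X : RSystem R) : ∀ (n : ℕ) (x : (X.Q.tpow (n + 1)).carrier),
    ∃ s : Finset X.Q.carrier, ∀ l : List (X.Q.carrier × X.P.carrier),
      (∀ q ∈ s, X.rankList l 0 q = q) → X.rankList l n x = x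
  | 0, x => ⟨{x}, fun _ h => h x (Finset.mem_singleton_self x)⟩
  | n + 1, x => by
    classical
    induction x using tensor_induction (M := X.Q.tpow (n + 1)) (N := X.Q) with
    | zero => exact ⟨∅, fun l _ => map_zero (X.rankList l (n + 1))⟩
    | tmul x y =>
      obtain ⟨s, hs⟩ := exists_finset_rankList X n x
      exact ⟨s, fun l hl => by rw [rankList_tmul, hs l hl]⟩
    | add x y hx hy =>
      obtain ⟨s, hs⟩ := hx
      obtain ⟨t, ht⟩ := hy
      exact ⟨s ∪ t, fun l hl => (map_add (X.rankList l (n + 1)) x y).trans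
        (congrArg₂ (· + ·) (hs l fun q hq => hl q (Finset.mem_union_left t hq))
          (ht l fun q hq => hl q (Finset.mem_union_right s hq)))⟩

theorem exists_rankList_of_mem_finiteRank (X : RSystem R) {Θ : AddMonoid.End X.Q.carrier}
    (h : Θ ∈ X.finiteRank) : ∃ l, ∀ q, X.rankList l 0 q = Θ q := by
  induction h using AddSubgroup.closure_induction with
  | mem Θ h =>
    obtain ⟨q, p, rfl⟩ := h
    exact ⟨[(q, p)], fun x => (X.rankList_cons (q, p) [] 0 x).trans (add_zero _)⟩
  | zero => exact ⟨[], fun _ => rfl⟩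
  | add Θ Θ' _ _ h h' =>
    obtain ⟨l, hl⟩ := h
    obtain ⟨l', hl'⟩ := h'
    exact ⟨l ++ l', fun q => (DFunLike.congr_fun (X.rankList_append l l' 0) q).trans
      (congrArg₂ (· + ·) (hl q) (hl' q))⟩
  | neg Θ _ h =>
    obtain ⟨l, hl⟩ := h
    -- Lists carry no signs, so the sign goes into the vector: -θ_{q,p} = θ_{-q,p}.
    refine ⟨l.map fun z => (-z.1, z.2), fun q => Eq.trans ?_ (congrArg Neg.neg (hl q))⟩
    clear hl
    induction l with
    | nil => exact (neg_zero (G := X.Q.carrier)).symm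
    | cons z l ih =>
      rw [List.map_cons, rankList_cons, rankList_cons, ih]
      refine Eq.trans ?_ (neg_add _ _).symm
      exact congrArg (· + _) (map_neg (X.Q.rsmul _) z.1)

/-! ### Non-degeneracy of F(Q) as a right R-module -/

/-- Under condition (FS), the maps `S_p^{(n)}` separate the elements of `Q^{⊗(n+1)}`. -/
theorem FS.eq_zero_of_contractLeft {X : RSystem R} (hX : X.FS) (n : ℕ)
    (x : (X.Q.tpow (n + 1)).carrier) (h : ∀ p, (X.contractLeft p n).toAddHom x = 0) : x = 0 := by
  obtain ⟨s, hs⟩ := X.exists_finset_rankList n x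
  obtain ⟨Θ, hΘ, -, -, hs', -⟩ := hX s ∅
  obtain ⟨l, hl⟩ := X.exists_rankList_of_mem_finiteRank hΘ
  -- Now x = ∑ qᵢ ⊗ S_{pᵢ} x, and every term vanishes by hypothesis.
  rw [← hs l fun q hq => (hl q).trans (hs' q hq)]
  clear hl
  induction l with
  | nil => rfl
  | cons z l ih => rw [rankList_cons, ih, h, map_zero, add_zero]

/-- Since S_p is right linear, x R = 0 forces S_p(x) R = 0 one degree lower, and the S_p separate
points. The descent ends in degree 0, where the claim is right non-degeneracy of R itself. -/
theorem FS.eq_zero_of_rsmul {X : RSystem R} (hX : X.FS) (hR : RightNondegenerate R) :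
    ∀ (n : ℕ) (x : (X.Q.tpow n).carrier), (∀ r, (X.Q.tpow n).rsmul r x = 0) → x = 0
  | 0, x, h => hR x h
  | n + 1, x, h => hX.eq_zero_of_contractLeft n x fun p =>
      hX.eq_zero_of_rsmul hR n _ fun r => by
        rw [← (X.contractLeft p n).map_rsmul, h r, map_zero]

theorem FS.eq_zero_of_fock_rsmul {X : RSystem R} (hX : X.FS) (hR : RightNondegenerate R)
    (x : X.Q.fock.carrier) (h : ∀ r, X.Q.fock.rsmul r x = 0) : x = 0 :=
  DFinsupp.ext fun n => hX.eq_zero_of_rsmul hR n (X.Q.proj n x) fun r => by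
    rw [← fock_rsmul_proj, h r, map_zero]

/-! ### Condition (FS) on P in terms of lists -/

theorem exists_list_of_mem_finiteRankAdj (X : RSystem R) {Δ : AddMonoid.End X.P.carrier}
    (h : Δ ∈ X.finiteRankAdj) : ∃ l : List (X.P.carrier × X.Q.carrier),
      ∀ p, (l.map fun z => X.P.lsmul (X.pair p z.2) z.1).sum = Δ p := by
  induction h using AddSubgroup.closure_induction with
  | mem Δ h =>
    obtain ⟨p, q, rfl⟩ := h
    exact ⟨[(p, q)], fun y => by
      rw [List.map_singleton, List.sum_singleton]
      rfl⟩
  | zero => exact ⟨[], fun _ => rfl⟩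
  | add Δ Δ' _ _ h h' =>
    obtain ⟨l, hl⟩ := h
    obtain ⟨l', hl'⟩ := h'
    exact ⟨l ++ l', fun p => by rw [List.map_append, List.sum_append, hl, hl']; rfl⟩
  | neg Δ _ h =>
    obtain ⟨l, hl⟩ := h
    refine ⟨l.map fun z => (-z.1, z.2), fun p => Eq.trans ?_ (congrArg Neg.neg (hl p))⟩
    simp [List.sum_neg, Function.comp_def]

theorem FS.exists_list {X : RSystem R} (hX : X.FS) (t : Finset X.P.carrier) :
    ∃ l : List (X.P.carrier × X.Q.carrier),
      ∀ p ∈ t, (l.map fun z => X.P.lsmul (X.pair p z.2) z.1).sum = p := by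
  obtain ⟨-, -, Δ, hΔ, -, ht⟩ := hX ∅ t
  obtain ⟨l, hl⟩ := X.exists_list_of_mem_finiteRankAdj hΔ
  exact ⟨l, fun p hp => (hl p).trans (ht p hp)⟩

end RSystem

/-! ### The maps T^n and their sum F(Q) → B -/

namespace CovariantRep

open RingBimodule RSystem

variable {R : Type u} [NonUnitalRing R] {X : RSystem R}
  {B : Type v} [NonUnitalRing B] (ρ : CovariantRep X B)

/-- The maps `T^n : Q^{⊗n} → B`, `q₁ ⊗ ⋯ ⊗ qₙ ↦ T(q₁) ⋯ T(qₙ)` with `T^0 = σ`, bundled with their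
right linearity. -/
def powerTAux : (n : ℕ) →
    {f : (X.Q.tpow n).carrier →+ B // ∀ x r, f ((X.Q.tpow n).rsmul r x) = f x * ρ.σ r}
  | 0 => ⟨ρ.σ.toAddMonoidHom, fun (x : R) r => map_mul ρ.σ x r⟩
  | 1 => ⟨ρ.T, ρ.T_rsmul⟩
  | n + 2 =>
    -- Right linearity of the previous map is exactly what makes (x, q) ↦ T^{n+1}(x) T(q) balanced,
    -- which is why map and linearity are constructed together.
    have hb : ∀ (x : (X.Q.tpow (n + 1)).carrier) (r : R) (q : X.Q.carrier),
        (powerTAux (n + 1)).1 ((X.Q.tpow (n + 1)).rsmul r x) * ρ.T q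
          = (powerTAux (n + 1)).1 x * ρ.T (X.Q.lsmul r q) := fun x r q => by
      rw [(powerTAux (n + 1)).2, ρ.T_lsmul, mul_assoc]
    ⟨tlift ((AddMonoidHom.mul.comp (powerTAux (n + 1)).1).compl₂ ρ.T) hb,
      fun z r => DFunLike.congr_fun (tensor_ext
        (f := (tlift ((AddMonoidHom.mul.comp (powerTAux (n + 1)).1).compl₂ ρ.T) hb).comp
          ((X.Q.tpow (n + 2)).rsmul r))
        (g := (AddMonoidHom.mulRight (ρ.σ r)).comp
          (tlift ((AddMonoidHom.mul.comp (powerTAux (n + 1)).1).compl₂ ρ.T) hb))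
        (fun x q => by
          change (powerTAux (n + 1)).1 x * ρ.T (X.Q.rsmul r q)
            = (powerTAux (n + 1)).1 x * ρ.T q * ρ.σ r
          rw [ρ.T_rsmul, mul_assoc])) z⟩

/-- The map `T^n : Q^{⊗n} → B`. -/
def powerT (n : ℕ) : (X.Q.tpow n).carrier →+ B := (ρ.powerTAux n).1

theorem powerT_rsmul (n : ℕ) (x : (X.Q.tpow n).carrier) (r : R) :
    ρ.powerT n ((X.Q.tpow n).rsmul r x) = ρ.powerT n x * ρ.σ r := (ρ.powerTAux n).2 x r

theorem powerT_tensorRight (q : X.Q.carrier) : ∀ (n : ℕ) (x : (X.Q.tpow n).carrier),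
    ρ.powerT (n + 1) ((X.Q.tensorRight q n).toAddHom x) = ρ.powerT n x * ρ.T q
  | 0, x => ρ.T_lsmul q x
  | _ + 1, _ => rfl

/-- The map `F(Q) → B` that agrees with `T^n` on `Q^{⊗n}`. -/
def fockMap : X.Q.fock.carrier →+ B :=
  DirectSum.toAddMonoid (β := fun n => (X.Q.tpow n).carrier) ρ.powerT

theorem fockMap_incl (n : ℕ) (x : (X.Q.tpow n).carrier) :
    ρ.fockMap (X.Q.incl n x) = ρ.powerT n x :=
  DirectSum.toAddMonoid_of (β := fun n => (X.Q.tpow n).carrier) _ n x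

theorem fockMap_rsmul (x : X.Q.fock.carrier) (r : R) :
    ρ.fockMap (X.Q.fock.rsmul r x) = ρ.fockMap x * ρ.σ r :=
  DFunLike.congr_fun (fock_ext (M := X.Q) (f := ρ.fockMap.comp (X.Q.fock.rsmul r))
    (g := (AddMonoidHom.mulRight (ρ.σ r)).comp ρ.fockMap) fun n x => by
      change ρ.fockMap (X.Q.fock.rsmul r (X.Q.incl n x)) = ρ.fockMap (X.Q.incl n x) * ρ.σ r
      rw [fock_rsmul_incl, fockMap_incl, fockMap_incl, powerT_rsmul]) x

theorem fockMap_tensorRight (x : X.Q.fock.carrier) (q : X.Q.carrier) :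
    ρ.fockMap (shiftUp (fun n => (X.Q.tensorRight q n).toAddHom) x) = ρ.fockMap x * ρ.T q :=
  DFunLike.congr_fun (fock_ext (M := X.Q)
    (f := ρ.fockMap.comp (shiftUp fun n => (X.Q.tensorRight q n).toAddHom))
    (g := (AddMonoidHom.mulRight (ρ.T q)).comp ρ.fockMap) fun n x => by
      change ρ.fockMap (shiftUp _ (X.Q.incl n x)) = ρ.fockMap (X.Q.incl n x) * ρ.T q
      rw [shiftUp_incl, fockMap_incl, fockMap_incl, powerT_tensorRight]) x

/-! ### The filtration by the number of factors S -/

/-- The sums of products `T(q₁) ⋯ T(qₖ) S(p₁) ⋯ S(pₗ)` with `l ≤ n`. -/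
def filtration : ℕ → AddSubgroup B
  | 0 => ρ.fockMap.range
  | n + 1 => ρ.fockMap.range ⊔
      AddSubgroup.closure {c | ∃ b ∈ filtration n, ∃ p, c = b * ρ.S p}

theorem range_fockMap_le_filtration : ∀ n, ρ.fockMap.range ≤ ρ.filtration n
  | 0 => le_rfl
  | _ + 1 => le_sup_left

theorem mul_S_mem_filtration {n : ℕ} {b : B} (hb : b ∈ ρ.filtration n) (p : X.P.carrier) :
    b * ρ.S p ∈ ρ.filtration (n + 1) :=
  le_sup_right (a := ρ.fockMap.range) (AddSubgroup.subset_closure ⟨b, hb, p, rfl⟩)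

theorem filtration_le_succ : ∀ n, ρ.filtration n ≤ ρ.filtration (n + 1)
  | 0 => ρ.range_fockMap_le_filtration 1
  | n + 1 => by
    refine sup_le_sup_left (AddSubgroup.closure_mono ?_) ρ.fockMap.range
    rintro _ ⟨b, hb, p, rfl⟩
    exact ⟨b, filtration_le_succ n hb, p, rfl⟩

theorem filtration_mono : Monotone ρ.filtration := monotone_nat_of_le_succ ρ.filtration_le_succ

/-- The last factor absorbs the scalar: S(p)σ(r) = S(pr), and T^n(x)σ(r) = T^n(xr) when there is no
S. Hence a case distinction suffices and no induction is needed. -/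
theorem mul_σ_mem_filtration {n : ℕ} {b : B} (hb : b ∈ ρ.filtration n) (r : R) :
    b * ρ.σ r ∈ ρ.filtration n := by
  revert b
  change ρ.filtration n ≤ (ρ.filtration n).comap (AddMonoidHom.mulRight (ρ.σ r))
  have h0 (n : ℕ) :
      ρ.fockMap.range ≤ (ρ.filtration n).comap (AddMonoidHom.mulRight (ρ.σ r)) := by
    rintro _ ⟨x, rfl⟩
    exact ρ.range_fockMap_le_filtration n ⟨_, ρ.fockMap_rsmul x r⟩
  cases n with
  | zero => exact h0 0
  | succ n =>
    refine sup_le (h0 _) ((AddSubgroup.closure_le _).2 ?_)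
    rintro _ ⟨b, hb, p, rfl⟩
    change b * ρ.S p * ρ.σ r ∈ ρ.filtration (n + 1)
    rw [mul_assoc, ← ρ.S_rsmul]
    exact ρ.mul_S_mem_filtration hb _

/-- A final S(p) meets T(q) and becomes the scalar σ(ψ(p ⊗ q)), so one factor S is lost. This drop
in level makes the induction in the injectivity proof possible. -/
theorem mul_T_mem_filtration_of_mem_closure {n : ℕ} {c : B}
    (hc : c ∈ AddSubgroup.closure {c | ∃ b ∈ ρ.filtration n, ∃ p, c = b * ρ.S p})
    (q : X.Q.carrier) : c * ρ.T q ∈ ρ.filtration n := by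
  revert c
  change _ ≤ (ρ.filtration n).comap (AddMonoidHom.mulRight (ρ.T q))
  refine (AddSubgroup.closure_le _).2 ?_
  rintro _ ⟨b, hb, p, rfl⟩
  change b * ρ.S p * ρ.T q ∈ ρ.filtration n
  rw [mul_assoc, ← ρ.σ_pair]
  exact ρ.mul_σ_mem_filtration hb _

theorem mul_T_mem_filtration {n : ℕ} {b : B} (hb : b ∈ ρ.filtration n) (q : X.Q.carrier) :
    b * ρ.T q ∈ ρ.filtration n := by
  revert b
  change ρ.filtration n ≤ (ρ.filtration n).comap (AddMonoidHom.mulRight (ρ.T q))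
  have h0 (n : ℕ) :
      ρ.fockMap.range ≤ (ρ.filtration n).comap (AddMonoidHom.mulRight (ρ.T q)) := by
    rintro _ ⟨x, rfl⟩
    exact ρ.range_fockMap_le_filtration n ⟨_, ρ.fockMap_tensorRight x q⟩
  cases n with
  | zero => exact h0 0
  | succ n =>
    exact sup_le (h0 _) fun c hc =>
      ρ.filtration_le_succ n (ρ.mul_T_mem_filtration_of_mem_closure hc q)

/-! ### Local right units ∑ T(qᵢ)S(pᵢ), and exhaustion by the filtration -/

/-- Covariance gives ∑ S(p)T(qᵢ)S(pᵢ) = S(∑ ψ(p ⊗ qᵢ)pᵢ), so an element of 𝓕_Q(P) that fixes p turns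
into a right unit for everything ending in S(p). -/
theorem sum_map_mul_T_mul_S (l : List (X.P.carrier × X.Q.carrier)) (b : B) (p : X.P.carrier)
    (hl : (l.map fun z => X.P.lsmul (X.pair p z.2) z.1).sum = p) :
    (l.map fun z => b * ρ.S p * ρ.T z.2 * ρ.S z.1).sum = b * ρ.S p := by
  conv_rhs => rw [← hl]
  clear hl
  induction l with
  | nil => simp
  | cons z l ih =>
    rw [List.map_cons, List.sum_cons, List.map_cons, List.sum_cons, ih, map_add, mul_add,
      ρ.S_lsmul, ρ.σ_pair]
    simp only [mul_assoc]

/-- The finite set collects the last factors p of the terms of c. As for Q, it precedes the list, so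
that a single choice from (FS) treats all terms at once. -/
theorem exists_finset_sum_map_mul_T_mul_S {n : ℕ} {c : B}
    (hc : c ∈ AddSubgroup.closure {c | ∃ b ∈ ρ.filtration n, ∃ p, c = b * ρ.S p}) :
    ∃ t : Finset X.P.carrier, ∀ l : List (X.P.carrier × X.Q.carrier),
      (∀ p ∈ t, (l.map fun z => X.P.lsmul (X.pair p z.2) z.1).sum = p) →
        (l.map fun z => c * ρ.T z.2 * ρ.S z.1).sum = c := by
  classical
  induction hc using AddSubgroup.closure_induction with
  | mem c hc =>
    obtain ⟨b, -, p, rfl⟩ := hc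
    exact ⟨{p}, fun l hl => ρ.sum_map_mul_T_mul_S l b p (hl p (Finset.mem_singleton_self p))⟩
  | zero => exact ⟨∅, fun l _ => by simp⟩
  | add c c' _ _ h h' =>
    obtain ⟨s, hs⟩ := h
    obtain ⟨t, ht⟩ := h'
    refine ⟨s ∪ t, fun l hl => ?_⟩
    conv_rhs => rw [← hs l fun q hq => hl q (Finset.mem_union_left t hq),
      ← ht l fun q hq => hl q (Finset.mem_union_right s hq)]
    simp [add_mul, List.sum_map_add]
  | neg c _ h =>
    obtain ⟨s, hs⟩ := h
    refine ⟨s, fun l hl => ?_⟩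
    conv_rhs => rw [← hs l hl]
    simp [List.sum_neg, Function.comp_def]

theorem exists_mem_filtration (hX : X.FS) (hρ : ρ.IsSurjective) (a : B) :
    ∃ n, a ∈ ρ.filtration n := by
  -- Induction over the generated ring must handle products. Knowing in addition that right
  -- multiplication by a preserves the union of the filtration makes that case immediate, and for
  -- generators it is the three closure lemmas above.
  suffices h : (∃ n, a ∈ ρ.filtration n) ∧
      ∀ n, ∀ b ∈ ρ.filtration n, ∃ m, b * a ∈ ρ.filtration m from h.1
  have ha : a ∈ NonUnitalSubring.closure ρ.generators := hρ ▸ NonUnitalSubring.mem_top a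
  induction ha using NonUnitalSubring.closure_induction with
  | mem a ha =>
    rcases ha with (⟨r, rfl⟩ | ⟨q, rfl⟩) | ⟨p, rfl⟩
    · exact ⟨⟨0, X.Q.incl 0 r, ρ.fockMap_incl 0 r⟩,
        fun n b hb => ⟨n, ρ.mul_σ_mem_filtration hb r⟩⟩
    · exact ⟨⟨0, X.Q.incl 1 q, ρ.fockMap_incl 1 q⟩,
        fun n b hb => ⟨n, ρ.mul_T_mem_filtration hb q⟩⟩
    · refine ⟨⟨1, ?_⟩, fun n b hb => ⟨n + 1, ρ.mul_S_mem_filtration hb p⟩⟩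
      -- Without a unit, a bare S(p) is not visibly a level 0 element times some S. Condition (FS)
      -- supplies S(p) = ∑ σ(ψ(p ⊗ qᵢ)) S(pᵢ), with coefficients from σ(R) in level 0.
      obtain ⟨l, hl⟩ := hX.exists_list {p}
      rw [← hl p (Finset.mem_singleton_self p), map_list_sum]
      refine list_sum_mem fun c hc => ?_
      simp only [List.mem_map] at hc
      obtain ⟨_, ⟨z, -, rfl⟩, rfl⟩ := hc
      rw [ρ.S_lsmul]
      exact ρ.mul_S_mem_filtration (n := 0) ⟨X.Q.incl 0 _, ρ.fockMap_incl 0 _⟩ z.1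
  | zero => exact ⟨⟨0, zero_mem _⟩, fun n b _ => ⟨0, by rw [mul_zero]; exact zero_mem _⟩⟩
  | add x y _ _ hx hy =>
    have hadd {c d : B} : (∃ n, c ∈ ρ.filtration n) → (∃ n, d ∈ ρ.filtration n) →
        ∃ n, c + d ∈ ρ.filtration n := fun ⟨m, hm⟩ ⟨n, hn⟩ => ⟨max m n, add_mem
      (ρ.filtration_mono (le_max_left m n) hm) (ρ.filtration_mono (le_max_right m n) hn)⟩
    exact ⟨hadd hx.1 hy.1, fun n b hb => by
      rw [mul_add]
      exact hadd (hx.2 n b hb) (hy.2 n b hb)⟩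
  | neg x _ hx =>
    exact ⟨hx.1.imp fun _ => neg_mem, fun n b hb => by
      rw [mul_neg]
      exact (hx.2 n b hb).imp fun _ => neg_mem⟩
  | mul x y _ _ hx hy =>
    have hmul {b : B} : (∃ n, b ∈ ρ.filtration n) → ∃ n, b * y ∈ ρ.filtration n :=
      fun ⟨n, hn⟩ => hy.2 n b hn
    exact ⟨hmul hx.1, fun n b hb => by
      rw [← mul_assoc]
      exact hmul (hx.2 n b hb)⟩

/-! ### Naturality of the maps T^n -/

/-- A homomorphism of covariant representations is compatible with the maps `T^n`. -/
theorem map_powerT {C : Type w} [NonUnitalRing C] {ρ : CovariantRep X B} {τ : CovariantRep X C}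
    {η : B →ₙ+* C} (hσ : ∀ r, η (ρ.σ r) = τ.σ r) (hT : ∀ q, η (ρ.T q) = τ.T q) :
    ∀ (n : ℕ) (x : (X.Q.tpow n).carrier), η (ρ.powerT n x) = τ.powerT n x
  | 0, x => hσ x
  | 1, x => hT x
  | n + 2, x => DFunLike.congr_fun (tensor_ext
      (f := η.toAddMonoidHom.comp (ρ.powerT (n + 2))) (g := τ.powerT (n + 2)) fun y q => by
        change η (ρ.powerT (n + 1) y * ρ.T q) = τ.powerT (n + 1) y * τ.T q
        rw [map_mul, map_powerT hσ hT (n + 1) y, hT]) x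

theorem map_fockMap {C : Type w} [NonUnitalRing C] {ρ : CovariantRep X B} {τ : CovariantRep X C}
    {η : B →ₙ+* C} (hσ : ∀ r, η (ρ.σ r) = τ.σ r) (hT : ∀ q, η (ρ.T q) = τ.T q)
    (x : X.Q.fock.carrier) : η (ρ.fockMap x) = τ.fockMap x :=
  DFunLike.congr_fun (fock_ext (M := X.Q) (f := η.toAddMonoidHom.comp ρ.fockMap)
    (g := τ.fockMap) fun n x => by
      change η (ρ.fockMap (X.Q.incl n x)) = τ.fockMap (X.Q.incl n x)
      rw [fockMap_incl, fockMap_incl, map_powerT hσ hT]) x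

end CovariantRep

/-! ### The Fock ring acting on Q^{⊗0} = R -/

namespace RSystem

open RingBimodule

variable {R : Type u} [NonUnitalRing R]

/-- The action of the Fock ring on `F(Q)`. -/
def fockAction (X : RSystem R) : X.fockRing →+ X.Q.fock.carrier →+ X.Q.fock.carrier :=
  AddMonoidHom.mk' (fun b => b.1.1) fun _ _ => rfl

theorem fockAction_mul (X : RSystem R) (b c : X.fockRing) (y : X.Q.fock.carrier) :
    X.fockAction (b * c) y = X.fockAction b (X.fockAction c y) := rfl

theorem fockAction_σ_incl (X : RSystem R) (r : R) (n : ℕ) (x : (X.Q.tpow n).carrier) :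
    X.fockAction (X.fockRep.σ r) (X.Q.incl n x) = X.Q.incl n ((X.Q.tpow n).lsmul r x) :=
  fock_lsmul_incl X.Q r n x

theorem fockAction_T_incl (X : RSystem R) (q : X.Q.carrier) (n : ℕ) (x : (X.Q.tpow n).carrier) :
    X.fockAction (X.fockRep.T q) (X.Q.incl n x)
      = X.Q.incl (n + 1) ((X.Q.tensorLeft q n).toAddHom x) :=
  shiftUp_incl _ n x

theorem fockAction_S_incl_zero (X : RSystem R) (p : X.P.carrier) (r : R) :
    X.fockAction (X.fockRep.S p) (X.Q.incl 0 r) = 0 :=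
  shiftDown_incl_zero _ r

/-- The map `x ↦ x ⊗ q` on `F(Q)`. -/
def fockTensorRight (X : RSystem R) (q : X.Q.carrier) : X.Q.fock.carrier →+ X.Q.fock.carrier :=
  shiftUp fun n => (X.Q.tensorRight q n).toAddHom

theorem fockTensorRight_incl (X : RSystem R) (q : X.Q.carrier) (n : ℕ)
    (x : (X.Q.tpow n).carrier) :
    X.fockTensorRight q (X.Q.incl n x) = X.Q.incl (n + 1) ((X.Q.tensorRight q n).toAddHom x) :=
  shiftUp_incl _ n x

theorem tensorLeft_tensorRight (M : RingBimodule R) (m m' : M.carrier) :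
    ∀ (n : ℕ) (x : (M.tpow n).carrier),
      (M.tensorLeft m (n + 1)).toAddHom ((M.tensorRight m' n).toAddHom x)
        = (M.tensorRight m' (n + 1)).toAddHom ((M.tensorLeft m n).toAddHom x)
  | 0, r => (tmul_balanced M M m r m').symm
  | _ + 1, _ => rfl

/-- Scalars and creation operators touch only the left end, so they commute with tensoring on the
right. Annihilation operators do not: S_p kills r in degree 0 but sends rq to ψ(p ⊗ rq). -/
theorem fockAction_powerT_fockTensorRight (X : RSystem R) (q : X.Q.carrier) :
    ∀ (n : ℕ) (x : (X.Q.tpow n).carrier) (y : X.Q.fock.carrier),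
      X.fockAction (X.fockRep.powerT n x) (X.fockTensorRight q y)
        = X.fockTensorRight q (X.fockAction (X.fockRep.powerT n x) y)
  | 0, (r : R), y => DFunLike.congr_fun (fock_ext (M := X.Q)
      (f := (X.fockAction (X.fockRep.σ r)).comp (X.fockTensorRight q))
      (g := (X.fockTensorRight q).comp (X.fockAction (X.fockRep.σ r))) fun n x => by
        rw [AddMonoidHom.comp_apply, AddMonoidHom.comp_apply, fockTensorRight_incl,
          fockAction_σ_incl, fockAction_σ_incl, fockTensorRight_incl,
          (X.Q.tensorRight q n).map_lsmul]) y
  | 1, (q' : X.Q.carrier), y => DFunLike.congr_fun (fock_ext (M := X.Q)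
      (f := (X.fockAction (X.fockRep.T q')).comp (X.fockTensorRight q))
      (g := (X.fockTensorRight q).comp (X.fockAction (X.fockRep.T q'))) fun n x => by
        rw [AddMonoidHom.comp_apply, AddMonoidHom.comp_apply, fockTensorRight_incl,
          fockAction_T_incl, fockAction_T_incl, fockTensorRight_incl,
          tensorLeft_tensorRight]) y
  | n + 2, x, y => DFunLike.congr_fun (tensor_ext
      (f := (X.fockAction.flip (X.fockTensorRight q y)).comp (X.fockRep.powerT (n + 2)))
      (g := (X.fockTensorRight q).comp ((X.fockAction.flip y).comp (X.fockRep.powerT (n + 2))))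
      fun x q' => by
        -- Reading T(q') as T^1(q') lets the degree 1 case be reused for the last factor.
        change X.fockAction (X.fockRep.powerT (n + 1) x * X.fockRep.powerT 1 q') _
          = X.fockTensorRight q
            (X.fockAction (X.fockRep.powerT (n + 1) x * X.fockRep.powerT 1 q') y)
        rw [fockAction_mul, fockAction_mul, X.fockAction_powerT_fockTensorRight q 1 q' y,
          X.fockAction_powerT_fockTensorRight q (n + 1) x]) x

/-- Tensor powers grow on the right while creation operators add factors on the left. Commutation
with right tensoring reconciles the two. -/
theorem fockAction_powerT_incl_one (X : RSystem R) (q : X.Q.carrier) :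
    ∀ (n : ℕ) (x : (X.Q.tpow n).carrier),
      X.fockAction (X.fockRep.powerT n x) (X.Q.incl 1 q)
        = X.Q.incl (n + 1) ((X.Q.tensorRight q n).toAddHom x)
  | 0, r => X.fockAction_σ_incl r 1 q
  | 1, q' => X.fockAction_T_incl q' 1 q
  | n + 2, x => DFunLike.congr_fun (tensor_ext
      (f := (X.fockAction.flip (X.Q.incl 1 q)).comp (X.fockRep.powerT (n + 2)))
      (g := (X.Q.incl (n + 3)).comp (X.Q.tensorRight q (n + 2)).toAddHom) fun x q' => by
        change X.fockAction (X.fockRep.powerT (n + 1) x)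
            (X.fockAction (X.fockRep.T q') (X.Q.incl 1 q))
          = X.Q.incl (n + 3) ((X.Q.tensorRight q (n + 2)).toAddHom
            ((X.Q.tensorRight q' (n + 1)).toAddHom x))
        -- The vector q' ⊗ q, created from q by T_{q'}, is also q' tensored on the right with q. The
        -- factor q can then be pulled outside, leaving T^{n+1}(x) acting on q' in degree 1.
        have h : X.fockAction (X.fockRep.T q') (X.Q.incl 1 q)
            = X.fockTensorRight q (X.Q.incl 1 q') :=
          (X.fockAction_T_incl q' 1 q).trans (X.fockTensorRight_incl q 1 q').symm
        rw [h, fockAction_powerT_fockTensorRight, X.fockAction_powerT_incl_one q' (n + 1) x,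
          fockTensorRight_incl]) x

theorem fockAction_powerT_incl_zero (X : RSystem R) (r : R) :
    ∀ (n : ℕ) (x : (X.Q.tpow n).carrier),
      X.fockAction (X.fockRep.powerT n x) (X.Q.incl 0 r)
        = X.Q.incl n ((X.Q.tpow n).rsmul r x)
  | 0, s => X.fockAction_σ_incl s 0 r
  | 1, q => X.fockAction_T_incl q 0 r
  | n + 2, x => DFunLike.congr_fun (tensor_ext
      (f := (X.fockAction.flip (X.Q.incl 0 r)).comp (X.fockRep.powerT (n + 2)))
      (g := (X.Q.incl (n + 2)).comp ((X.Q.tpow (n + 2)).rsmul r)) fun x q => by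
        change X.fockAction (X.fockRep.powerT (n + 1) x)
            (X.fockAction (X.fockRep.T q) (X.Q.incl 0 r))
          -- Here (x ⊗ q) r = x ⊗ qr, and qr is what T_q makes of r, so the action on degree 1
          -- settles the claim.
          = X.Q.incl (n + 2) ((X.Q.tensorRight (X.Q.rsmul r q) (n + 1)).toAddHom x)
        exact (congrArg _ (X.fockAction_T_incl q 0 r)).trans
          (X.fockAction_powerT_incl_one (X.Q.rsmul r q) (n + 1) x)) x

/-- This replaces evaluation at a vacuum vector: as R need not have a unit, only the products x r
are visible, and non-degeneracy of F(Q) has to recover x from them. -/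
theorem fockAction_fockMap_incl_zero (X : RSystem R) (r : R) (x : X.Q.fock.carrier) :
    X.fockAction (X.fockRep.fockMap x) (X.Q.incl 0 r) = X.Q.fock.rsmul r x :=
  DFunLike.congr_fun (fock_ext (M := X.Q)
    (f := (X.fockAction.flip (X.Q.incl 0 r)).comp X.fockRep.fockMap) (g := X.Q.fock.rsmul r)
    fun n x => by
      change X.fockAction (X.fockRep.fockMap (X.Q.incl n x)) (X.Q.incl 0 r)
        = X.Q.fock.rsmul r (X.Q.incl n x)
      rw [CovariantRep.fockMap_incl, fockAction_powerT_incl_zero, fock_rsmul_incl]) x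

end RSystem

/-! ### Injectivity on each level of the filtration -/

namespace CovariantRep

open RingBimodule RSystem

variable {R : Type u} [NonUnitalRing R] {X : RSystem R}
  {B : Type v} [NonUnitalRing B] {ρ : CovariantRep X B}

theorem eq_zero_of_mem_filtration (hR : RightNondegenerate R) (hX : X.FS)
    {η : B →ₙ+* X.fockRing} (hσ : ∀ r, η (ρ.σ r) = X.fockRep.σ r)
    (hT : ∀ q, η (ρ.T q) = X.fockRep.T q) (hS : ∀ p, η (ρ.S p) = X.fockRep.S p) :
    ∀ (n : ℕ) (a : B), a ∈ ρ.filtration n → η a = 0 → a = 0 := by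
  -- The S-free part is detected on degree 0, provided the rest acts there as zero. It is used with
  -- c = 0 on level 0 and with the part ending in S on higher levels.
  have key (x : X.Q.fock.carrier) (c : B)
      (hc : ∀ r : R, X.fockAction (η c) (X.Q.incl 0 r) = 0) (h : η (ρ.fockMap x + c) = 0) :
      x = 0 := hX.eq_zero_of_fock_rsmul hR x fun r => by
    rw [← X.fockAction_fockMap_incl_zero, ← map_fockMap hσ hT, eq_neg_of_add_eq_zero_left
      ((map_add η _ _).symm.trans h), map_neg, AddMonoidHom.neg_apply, hc, neg_zero]
  intro n
  induction n with
  | zero =>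
    rintro _ ⟨x, rfl⟩ ha
    rw [key x 0 (fun r => by rw [map_zero, map_zero]; rfl) (by rwa [add_zero]), map_zero]
  | succ n ih =>
    intro a ha h
    obtain ⟨_, ⟨x, rfl⟩, c, hc, rfl⟩ := AddSubgroup.mem_sup.1 ha
    -- The rightmost factor of each term acts first, and it is an annihilation operator, which kills
    -- degree 0.
    have hc0 (r : R) : X.fockAction (η c) (X.Q.incl 0 r) = 0 := by
      clear ha h
      induction hc using AddSubgroup.closure_induction with
      | mem c hc =>
        obtain ⟨b, -, p, rfl⟩ := hc
        rw [map_mul, hS, fockAction_mul, fockAction_S_incl_zero, map_zero]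
      | zero => rw [map_zero, map_zero]; rfl
      | add c d _ _ hc hd => rw [map_add, map_add, AddMonoidHom.add_apply, hc, hd, add_zero]
      | neg c _ hc => rw [map_neg, map_neg, AddMonoidHom.neg_apply, hc, neg_zero]
    obtain rfl := key x c hc0 h
    rw [map_zero, zero_add] at h ⊢
    -- Now c itself lies in the kernel. Expanding c = ∑ c T(qᵢ) S(pᵢ) reduces to the elements c
    -- T(qᵢ), which lie in level n and in the kernel, where the induction hypothesis applies.
    obtain ⟨t, ht⟩ := ρ.exists_finset_sum_map_mul_T_mul_S hc
    obtain ⟨l, hl⟩ := hX.exists_list t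
    rw [← ht l hl]
    refine List.sum_eq_zero fun d hd => ?_
    obtain ⟨z, -, rfl⟩ := List.mem_map.1 hd
    rw [ih _ (ρ.mul_T_mem_filtration_of_mem_closure hc z.2) (by rw [map_mul, h, zero_mul]),
      zero_mul]

end CovariantRep

end

/-! ### The isomorphism -/

theorem proposition4 {R : Type u} [NonUnitalRing R] (hR : RightNondegenerate R)
    (X : RSystem R) (hX : X.FS) :
    Nonempty (CovariantRep.Iso X.fockRep X.toeplitzRep) := by
  obtain ⟨η, ⟨hσ, hT, hS⟩, -⟩ := X.toeplitzRep_universal X.fockRep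
  have hinj : Function.Injective η := (injective_iff_map_eq_zero η).2 fun a ha =>
    have ⟨n, hn⟩ := X.toeplitzRep.exists_mem_filtration hX X.toeplitzRep_isSurjective a
    CovariantRep.eq_zero_of_mem_filtration hR hX hσ hT hS n a hn ha
  have hsurj : Function.Surjective η := fun b => by
    have hb : b ∈ NonUnitalSubring.closure X.fockRep.generators :=
      X.fockRep_isSurjective ▸ NonUnitalSubring.mem_top b
    refine (NonUnitalSubring.closure_le (t := η.range)).2 ?_ hb
    rintro _ ((⟨r, rfl⟩ | ⟨q, rfl⟩) | ⟨p, rfl⟩)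
    · exact ⟨_, hσ r⟩
    · exact ⟨_, hT q⟩
    · exact ⟨_, hS p⟩
  -- The universal map runs from the Toeplitz ring to the Fock ring, so the required isomorphism is
  -- its inverse.
  let e := RingEquiv.ofBijective η ⟨hinj, hsurj⟩
  exact ⟨⟨e.symm, fun p => e.symm_apply_eq.2 (hS p).symm, fun q => e.symm_apply_eq.2 (hT q).symm,
    fun r => e.symm_apply_eq.2 (hσ r).symm⟩⟩
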